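/- There is an absolute constant $c>0$ such that the following holds for all integers $d\ge 1$, $n_0\ge 11$ and $n$ for which $\log_2(n/n_0)$ is a positive integer, and for every query point $q\in[0,1]^d$. Draw $n$ points iid from the uniform distribution on $[0,1]^d$ and build their $k$-d tree with minimum leaf size $n_0$: starting at the root (level $0$, cell $[0,1]^d$) with all the points, a node of level $l$ that holds a set $S$ of at least $2n_0$ points is split along coordinate $\alpha=(l \bmod d)+1$ at the median $s$ of $\{p_\alpha : p\in S\}$ (the $\lceil |S|/2\rceil$-th order statistic); its left child gets the points and the part of the cell with $x_\alpha\le s$, its right child those with $x_\alpha> s$, both at level $l+1$. A node with fewer than $2n_0$ points is a leaf. Comprehensive search for $q$ starts at the root with no best point. At a leaf it replaces the best point so far by a point closest to $q$ among the points of the leaf and the best point so far. At an internal node it first searches the child on whose side of the split $q$ lies; then, if the cell of the other child intersects the open Euclidean ball centered at $q$ whose radius is the distance from $q$ to the best point found so far, it searches that child as well. Then, with probability at least $1-3n\exp(-c\,n_0)$, the number of leaf cells visited by comprehensive search on $q$ is at most $4\cdot(8\sqrt{2\pi e})^d$. -/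

import Mathlib

open MeasureTheory ProbabilityTheory

namespace KdTree

noncomputable section

/-- The cube `[0,1]^d` in Euclidean space: the cell of the root. -/
def unitCube (d : ℕ) : Set (EuclideanSpace ℝ (Fin d)) :=
  {x | ∀ a, x a ∈ Set.Icc (0 : ℝ) 1}

/-- The median of the values `f i`, `i ∈ S`, that is, their `⌈m/2⌉`-th order statistic with
`m = |S|`: the smallest real `x` such that at least `⌈m/2⌉` of the values are `≤ x`. -/
def median {ι : Type*} (S : Finset ι) (f : ι → ℝ) : ℝ :=
  sInf {x : ℝ | (S.card + 1) / 2 ≤ (S.filter (fun i => f i ≤ x)).card}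

/-- Trees whose leaves hold finite sets of (indices of) data points, and whose internal nodes
hold a split coordinate `a` and a split position `s`, encoding the rule `x a ≤ s`. -/
inductive Tree (d : ℕ) (ι : Type*) where
  | leaf (pts : Finset ι) : Tree d ι
  | node (a : Fin d) (s : ℝ) (left right : Tree d ι) : Tree d ι

/-- `Builds p n₀ l S T`: the tree-building procedure with minimum leaf size `n₀`, called at level
`l` on the data points `p i`, `i ∈ S`, terminates and returns `T`. A set of fewer than `2 n₀`
points becomes a leaf; a larger one is split at the median along coordinate `l mod d`.
(The procedure is deterministic, so there is at most one such `T`; there may be none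
if the data points have coordinates in common, since then the recursion may run forever.) -/
inductive Builds {d : ℕ} [NeZero d] {ι : Type*} (p : ι → EuclideanSpace ℝ (Fin d)) (n₀ : ℕ) :
    ℕ → Finset ι → Tree d ι → Prop where
  | leaf (l : ℕ) (S : Finset ι) (h : S.card < 2 * n₀) : Builds p n₀ l S (Tree.leaf S)
  | node (l : ℕ) (S : Finset ι) (a : Fin d) (s : ℝ) (left right : Tree d ι)
      (h : 2 * n₀ ≤ S.card)
      (ha : a = Fin.ofNat d l)
      (hs : s = median S (fun i => p i a))
      (hleft : Builds p n₀ (l + 1) (S.filter (fun i => p i a ≤ s)) left)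
      (hright : Builds p n₀ (l + 1) (S.filter (fun i => ¬ p i a ≤ s)) right) :
      Builds p n₀ l S (Tree.node a s left right)

open Classical in
/-- A data point of `A` closest to `q`, `none` (null) if `A` is empty. Ties are broken
arbitrarily; the search below uses only the distance from `q` to the point chosen. -/
def argmin {d : ℕ} {ι : Type*} (p : ι → EuclideanSpace ℝ (Fin d))
    (q : EuclideanSpace ℝ (Fin d)) (A : Finset ι) : Option ι :=
  if h : A.Nonempty then some (A.exists_min_image (fun i => dist (p i) q) h).choose else none

/-- The test for backtracking: the cell `C` meets the open ball centred at `q` whose radius is the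
distance from `q` to the best point found so far (infinite if there is none). -/
def Meets {d : ℕ} {ι : Type*} (p : ι → EuclideanSpace ℝ (Fin d))
    (q : EuclideanSpace ℝ (Fin d)) (C : Set (EuclideanSpace ℝ (Fin d))) : Option ι → Prop
  | none => C.Nonempty
  | some i => (C ∩ Metric.ball q (dist q (p i))).Nonempty

open Classical in
/-- Comprehensive search for `q`, called on a node with cell `C` and the current value of `best`.
It returns the new value of `best` and the list of the leaf cells visited, in order, with one
entry for each leaf visited. -/
def search {d : ℕ} {ι : Type*} (p : ι → EuclideanSpace ℝ (Fin d))
    (q : EuclideanSpace ℝ (Fin d)) :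
    Tree d ι → Set (EuclideanSpace ℝ (Fin d)) → Option ι →
      Option ι × List (Set (EuclideanSpace ℝ (Fin d)))
  | .leaf pts, C, best => (argmin p q (pts ∪ best.toFinset), [C])
  | .node a s left right, C, best =>
    let cellL := C ∩ {x | x a ≤ s}
    let cellR := C ∩ {x | ¬ x a ≤ s}
    if q a ≤ s then
      let r₁ := search p q left cellL best
      if Meets p q cellR r₁.1 then
        let r₂ := search p q right cellR r₁.1
        (r₂.1, r₁.2 ++ r₂.2)
      else r₁
    else
      let r₁ := search p q right cellR best
      if Meets p q cellL r₁.1 then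
        let r₂ := search p q left cellL r₁.1
        (r₂.1, r₁.2 ++ r₂.2)
      else r₁

/-- The number of leaf cells visited by comprehensive search on `q`, started at the root
with `best = null`. -/
def numVisited {d : ℕ} {ι : Type*} (p : ι → EuclideanSpace ℝ (Fin d))
    (q : EuclideanSpace ℝ (Fin d)) (T : Tree d ι) : ℕ :=
  (search p q T (unitCube d) none).2.length

end

end KdTree

set_option linter.unusedSectionVars false

/-! If every split lies close to the centre of its cell, the bound is deterministic. Each of the 2^k
leaf cells then has volume at least 2^(-k)/2 and sides at most 2·2^(-⌊k/d⌋), so diameter at most D =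
2√d·2^(-⌊k/d⌋). The search first descends to the leaf whose cell contains q; that leaf holds a data
point, so from then on the best point is within D of q. Every visited leaf cell comes within D of q,
hence lies in the ball of radius 2D about q. These cells are disjoint, and comparing volumes
(`length_search_mul_le`) with a Gaussian bound for the ball (`volume_closedBall_le`) gives
(8√(2πe))^d.

The probabilistic core is `measure_unbalanced_le`. A cell depends on the very points it holds, but
once the set T of points in its open cell and the positions of all other points are fixed, the cell
is fixed and the points of T are independent and uniform in it. Conditional distributions are
avoided: by `stateAt_eq_of_mem_box` and `stateAt_eq_of_mem_box_of_mem_box`, the event that T is the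
interior set is, in the coordinates of T, a power of one box. Hoeffding's inequality on that power
shows that the median is rarely far from the centre. Almost surely at most d points of a node lie on
the boundary of its cell, which is negligible when 24d ≤ n₀.

A node of height j holds 2^j n₀ points, so its tolerance may decay like (3/4)^j: slowly enough to
keep the Hoeffding exponents above n₀/288, fast enough for the relative errors along a path to
multiply to at least 1/2. A union bound covers the fewer than 2^k internal nodes. The condition 24d
≤ n₀ costs nothing: if k ≤ d, the tree has at most 2^d leaves; if k > d, either the claimed failure
bound is at least 1 or 24k ≤ n₀. -/

namespace KdTree

/-! ### Order statistics: stability of the median -/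

section Median

variable {ι : Type*} {S : Finset ι} {f : ι → ℝ}

theorem exists_isLeast_median (hS : S.Nonempty) :
    ∃ i ∈ S, IsLeast {x : ℝ | (S.card + 1) / 2 ≤ (S.filter (fun i => f i ≤ x)).card} (f i) := by
  classical
  have hpos : 0 < S.card := hS.card_pos
  -- An admissible x can be lowered to the largest data value below it, so the infimum is a minimum
  -- over finitely many data values.
  have key : ∀ x : ℝ, (S.card + 1) / 2 ≤ (S.filter (fun i => f i ≤ x)).card →
      ∃ i ∈ S, f i ≤ x ∧ (S.card + 1) / 2 ≤ (S.filter (fun j => f j ≤ f i)).card := by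
    intro x hx
    have hne : (S.filter (fun i => f i ≤ x)).Nonempty := Finset.card_pos.1 (by omega)
    obtain ⟨i, hi, hmax⟩ := Finset.exists_max_image _ f hne
    refine ⟨i, (Finset.mem_filter.1 hi).1, (Finset.mem_filter.1 hi).2, hx.trans ?_⟩
    refine Finset.card_le_card fun j hj => ?_
    exact Finset.mem_filter.2 ⟨(Finset.mem_filter.1 hj).1, hmax j hj⟩
  set A := S.filter (fun i => (S.card + 1) / 2 ≤ (S.filter (fun j => f j ≤ f i)).card) with hA
  have hAne : A.Nonempty := by
    obtain ⟨i, hi, hmax⟩ := Finset.exists_max_image S f hS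
    refine ⟨i, Finset.mem_filter.2 ⟨hi, ?_⟩⟩
    rw [Finset.filter_true_of_mem hmax]
    omega
  obtain ⟨i, hi, hmin⟩ := Finset.exists_min_image A f hAne
  refine ⟨i, (Finset.mem_filter.1 hi).1, (Finset.mem_filter.1 hi).2, fun x hx => ?_⟩
  obtain ⟨j, hj, hjx, hj'⟩ := key x hx
  exact (hmin j (Finset.mem_filter.2 ⟨hj, hj'⟩)).trans hjx

theorem isLeast_median (hS : S.Nonempty) :
    IsLeast {x : ℝ | (S.card + 1) / 2 ≤ (S.filter (fun i => f i ≤ x)).card} (median S f) := by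
  obtain ⟨i, -, hi⟩ := exists_isLeast_median (f := f) hS
  have : median S f = f i := hi.csInf_eq
  rwa [this]

theorem le_card_filter_le_median (hS : S.Nonempty) :
    (S.card + 1) / 2 ≤ (S.filter (fun i => f i ≤ median S f)).card :=
  (isLeast_median hS).1

theorem median_le_iff (hS : S.Nonempty) {t : ℝ} :
    median S f ≤ t ↔ (S.card + 1) / 2 ≤ (S.filter (fun i => f i ≤ t)).card := by
  refine ⟨fun h => (le_card_filter_le_median (f := f) hS).trans ?_, fun h => (isLeast_median hS).2 h⟩
  exact Finset.card_le_card (Finset.monotone_filter_right _ fun i _ hi => le_trans hi h)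

theorem card_filter_lt_median (hS : S.Nonempty) :
    (S.filter (fun i => f i < median S f)).card < (S.card + 1) / 2 := by
  by_contra! h
  have hpos : 0 < S.card := hS.card_pos
  obtain ⟨i, hi, hmax⟩ := Finset.exists_max_image (S.filter (fun i => f i < median S f)) f
    (Finset.card_pos.1 (by omega))
  have : median S f ≤ f i := by
    refine (median_le_iff hS).2 (h.trans (Finset.card_le_card fun j hj => ?_))
    exact Finset.mem_filter.2 ⟨(Finset.mem_filter.1 hj).1, hmax j hj⟩
  exact absurd (Finset.mem_filter.1 hi).2 (not_lt.2 this)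

theorem median_eq_of_card (hS : S.Nonempty) {t : ℝ}
    (h1 : (S.card + 1) / 2 ≤ (S.filter (fun i => f i ≤ t)).card)
    (h2 : (S.filter (fun i => f i < t)).card < (S.card + 1) / 2) : median S f = t := by
  refine le_antisymm ((median_le_iff hS).2 h1) (not_lt.1 fun hlt => ?_)
  refine absurd ((le_card_filter_le_median (f := f) hS).trans (Finset.card_le_card ?_)) (not_le.2 h2)
  exact Finset.monotone_filter_right _ fun i _ hi => lt_of_le_of_lt hi hlt

/-- The median does not change when points on one side of it are moved on the same side. -/
theorem median_congr_of_side {g : ι → ℝ}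
    (h1 : ∀ i ∈ S, f i ≤ median S f ↔ g i ≤ median S f)
    (h2 : ∀ i ∈ S, f i < median S f ↔ g i < median S f) : median S g = median S f := by
  rcases S.eq_empty_or_nonempty with rfl | hS
  · simp [median]
  refine median_eq_of_card hS ?_ ?_
  · rw [← Finset.filter_congr h1]; exact le_card_filter_le_median hS
  · rw [← Finset.filter_congr h2]; exact card_filter_lt_median hS

/-- Otherwise every value of `f` up to its median would give a value of `g` strictly below the
median of `g`: unmoved ones by the assumed inequality, moved ones by `h`. That is too many. -/
theorem median_le_of_below {g : ι → ℝ} (hS : S.Nonempty)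
    (h : ∀ i ∈ S, f i ≠ g i → g i < median S g) : median S g ≤ median S f := by
  by_contra! hlt
  refine absurd ((le_card_filter_le_median (f := f) hS).trans (Finset.card_le_card ?_))
    (not_le.2 (card_filter_lt_median (f := g) hS))
  refine Finset.monotone_filter_right _ fun i hi hle => ?_
  by_cases hfg : f i = g i
  · exact hfg ▸ lt_of_le_of_lt hle hlt
  · exact h i hi hfg

theorem median_le_of_above {g : ι → ℝ} (hS : S.Nonempty)
    (h : ∀ i ∈ S, f i ≠ g i → median S f < f i) : median S g ≤ median S f := by
  refine (median_le_iff hS).2 ((le_card_filter_le_median (f := f) hS).trans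
    (Finset.card_le_card ?_))
  refine Finset.monotone_filter_right _ fun i hi hle => ?_
  by_cases hfg : f i = g i
  · exact hfg ▸ hle
  · exact absurd hle (not_le.2 (h i hi hfg))

/-- Each configuration is compared only with its own median. This lets two nodes be identified when
neither is known in advance to have the other's split. -/
theorem median_eq_of_below {g : ι → ℝ}
    (hf : ∀ i ∈ S, f i ≠ g i → f i < median S f)
    (hg : ∀ i ∈ S, f i ≠ g i → g i < median S g) : median S f = median S g := by
  rcases S.eq_empty_or_nonempty with rfl | hS
  · simp [median]
  exact le_antisymm (median_le_of_below hS fun i hi h => hf i hi h.symm)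
    (median_le_of_below hS hg)

theorem median_eq_of_above {g : ι → ℝ}
    (hf : ∀ i ∈ S, f i ≠ g i → median S f < f i)
    (hg : ∀ i ∈ S, f i ≠ g i → median S g < g i) : median S f = median S g := by
  rcases S.eq_empty_or_nonempty with rfl | hS
  · simp [median]
  exact le_antisymm (median_le_of_above hS fun i hi h => hg i hi h.symm)
    (median_le_of_above hS hf)

theorem card_filter_le_median_of_injOn (hinj : Set.InjOn f S) {h : ℕ} (hh : 0 < h)
    (hc : S.card = 2 * h) : (S.filter (fun i => f i ≤ median S f)).card = h := by
  classical
  have hS : S.Nonempty := Finset.card_pos.1 (by omega)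
  have h1 := le_card_filter_le_median (f := f) hS
  have h2 := card_filter_lt_median (f := f) hS
  have h3 : (S.filter (fun i => f i ≤ median S f)).card ≤
      (S.filter (fun i => f i < median S f)).card + (S.filter (fun i => f i = median S f)).card := by
    refine le_trans (Finset.card_le_card fun i hi => ?_) (Finset.card_union_le _ _)
    have := Finset.mem_filter.1 hi
    rcases this.2.lt_or_eq with h' | h'
    · exact Finset.mem_union_left _ (Finset.mem_filter.2 ⟨this.1, h'⟩)
    · exact Finset.mem_union_right _ (Finset.mem_filter.2 ⟨this.1, h'⟩)
  have h4 : (S.filter (fun i => f i = median S f)).card ≤ 1 := by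
    refine Finset.card_le_one.2 fun i hi j hj => ?_
    have hi := Finset.mem_filter.1 hi
    have hj := Finset.mem_filter.1 hj
    exact hinj hi.1 hj.1 (hi.2.trans hj.2.symm)
  omega

end Median

end KdTree

/-! ### Nodes as functions of the configuration: locality and measurability -/

namespace KdTree

/-- The data held by a node (indices of the points) and the lower and upper corners of its cell. -/
structure State (d : ℕ) (ι : Type*) where
  S : Finset ι
  lo : Fin d → ℝ
  hi : Fin d → ℝ

namespace State

variable {d : ℕ} {ι : Type*}

/-- The open box with corners `lo`, `hi`. -/
def box (σ : State d ι) : Set (Fin d → ℝ) := Set.univ.pi fun a => Set.Ioo (σ.lo a) (σ.hi a)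

theorem mem_box {σ : State d ι} {y : Fin d → ℝ} :
    y ∈ σ.box ↔ ∀ a, σ.lo a < y a ∧ y a < σ.hi a := by simp [box]

/-- The split position of a node of level `l`. -/
noncomputable def split [NeZero d] (x : ι → Fin d → ℝ) (l : ℕ) (σ : State d ι) : ℝ :=
  median σ.S (fun i => x i (Fin.ofNat d l))

/-- The left (`true`) or right (`false`) child of a node of level `l`. -/
noncomputable def step [NeZero d] (x : ι → Fin d → ℝ) (l : ℕ) (b : Bool) (σ : State d ι) :
    State d ι :=
  if b then
    ⟨σ.S.filter fun i => x i (Fin.ofNat d l) ≤ σ.split x l, σ.lo,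
      fun a => if a = Fin.ofNat d l then min (σ.hi a) (σ.split x l) else σ.hi a⟩
  else
    ⟨σ.S.filter fun i => ¬ x i (Fin.ofNat d l) ≤ σ.split x l,
      fun a => if a = Fin.ofNat d l then max (σ.lo a) (σ.split x l) else σ.lo a, σ.hi⟩

/-- The `min` and `max` in `State.step` make boxes shrink along a path even if the split falls
outside the cell, so the nesting needs no general position. -/
theorem lo_le_step [NeZero d] (x : ι → Fin d → ℝ) (l : ℕ) (b : Bool) (σ : State d ι) (a : Fin d) :
    σ.lo a ≤ (σ.step x l b).lo a := by
  cases b <;> simp only [step, if_true, Bool.false_eq_true, if_false, le_refl]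
  split_ifs <;> simp

theorem step_hi_le [NeZero d] (x : ι → Fin d → ℝ) (l : ℕ) (b : Bool) (σ : State d ι) (a : Fin d) :
    (σ.step x l b).hi a ≤ σ.hi a := by
  cases b <;> simp only [step, if_true, Bool.false_eq_true, if_false, le_refl]
  split_ifs <;> simp

theorem box_step_subset [NeZero d] (x : ι → Fin d → ℝ) (l : ℕ) (b : Bool) (σ : State d ι) :
    (σ.step x l b).box ⊆ σ.box := fun _ hy => mem_box.2 fun a =>
  ⟨(lo_le_step x l b σ a).trans_lt (mem_box.1 hy a).1,
    (mem_box.1 hy a).2.trans_le (step_hi_le x l b σ a)⟩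

theorem lt_split_of_mem_box [NeZero d] {x : ι → Fin d → ℝ} {l : ℕ} {σ : State d ι}
    {y : Fin d → ℝ} (hy : y ∈ (σ.step x l true).box) : y (Fin.ofNat d l) < σ.split x l := by
  have := (mem_box.1 hy (Fin.ofNat d l)).2
  simp only [step, if_true] at this
  exact this.trans_le (min_le_right _ _)

theorem split_lt_of_mem_box [NeZero d] {x : ι → Fin d → ℝ} {l : ℕ} {σ : State d ι}
    {y : Fin d → ℝ} (hy : y ∈ (σ.step x l false).box) : σ.split x l < y (Fin.ofNat d l) := by
  have := (mem_box.1 hy (Fin.ofNat d l)).1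
  simp only [step, Bool.false_eq_true, if_true, if_false] at this
  exact (le_max_right _ _).trans_lt this

theorem step_congr [NeZero d] {x x' : ι → Fin d → ℝ} {l : ℕ} (b : Bool) {σ : State d ι}
    (h : σ.split x' l = σ.split x l)
    (h' : ∀ i ∈ σ.S, x i (Fin.ofNat d l) ≤ σ.split x l ↔ x' i (Fin.ofNat d l) ≤ σ.split x l) :
    σ.step x' l b = σ.step x l b := by
  cases b
  · simp only [step, Bool.false_eq_true, if_false, h, State.mk.injEq, and_true]
    exact Finset.filter_congr fun i hi => (not_congr (h' i hi)).symm
  · simp only [step, if_true, h, State.mk.injEq, and_true]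
    exact Finset.filter_congr fun i hi => (h' i hi).symm

end State

variable {d : ℕ} [NeZero d] {ι : Type*}

/-- The state of the node reached from the root by a path; the head of the list is the last
step of the path. -/
noncomputable def stateAt [Fintype ι] (x : ι → Fin d → ℝ) : List Bool → State d ι
  | [] => ⟨Finset.univ, fun _ => 0, fun _ => 1⟩
  | b :: π => (stateAt x π).step x π.length b

theorem measurable_card_filter {Ω : Type*} [MeasurableSpace Ω] (A : Finset ι)
    (p : ι → Ω → Prop) [∀ i ω, Decidable (p i ω)] (hp : ∀ i, MeasurableSet {ω | p i ω}) :
    Measurable fun ω => (A.filter fun i => p i ω).card := by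
  simp only [Finset.card_filter]
  exact Finset.measurable_sum _ fun i _ => Measurable.ite (hp i) measurable_const measurable_const

variable [Fintype ι]

open State

/-- Moving points inside the open cell of a node does not change the node. -/
theorem stateAt_eq_of_mem_box {x x' : ι → Fin d → ℝ} {T : Set ι} (hT : ∀ i ∉ T, x i = x' i) :
    ∀ π : List Bool, (∀ i ∈ T, x i ∈ (stateAt x π).box) → (∀ i ∈ T, x' i ∈ (stateAt x π).box) →
      stateAt x' π = stateAt x π
  | [], _, _ => rfl
  | b :: π, h, h' => by
    have ih := stateAt_eq_of_mem_box hT π (fun i hi => box_step_subset _ _ _ _ (h i hi))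
      (fun i hi => box_step_subset _ _ _ _ (h' i hi))
    have key : ∀ i, (x i (Fin.ofNat d π.length) ≤ (stateAt x π).split x π.length ↔
        x' i (Fin.ofNat d π.length) ≤ (stateAt x π).split x π.length) ∧
        (x i (Fin.ofNat d π.length) < (stateAt x π).split x π.length ↔
        x' i (Fin.ofNat d π.length) < (stateAt x π).split x π.length) := by
      intro i
      by_cases hi : i ∈ T
      · cases b
        · have h1 := split_lt_of_mem_box (h i hi)
          have h2 := split_lt_of_mem_box (h' i hi)
          exact ⟨iff_of_false (not_le.2 h1) (not_le.2 h2),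
            iff_of_false (not_lt.2 h1.le) (not_lt.2 h2.le)⟩
        · have h1 := lt_split_of_mem_box (h i hi)
          have h2 := lt_split_of_mem_box (h' i hi)
          exact ⟨iff_of_true h1.le h2.le, iff_of_true h1 h2⟩
      · rw [hT i hi]; exact ⟨Iff.rfl, Iff.rfl⟩
    simp only [stateAt]
    rw [ih]
    refine step_congr b ?_ fun i _ => (key i).1
    exact median_congr_of_side (fun i _ => (key i).1) fun i _ => (key i).2

/-- A node is determined by the points outside its open cell. -/
theorem stateAt_eq_of_mem_box_of_mem_box {x x' : ι → Fin d → ℝ} {T : Set ι}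
    (hT : ∀ i ∉ T, x i = x' i) :
    ∀ π : List Bool, (∀ i ∈ T, x i ∈ (stateAt x π).box) → (∀ i ∈ T, x' i ∈ (stateAt x' π).box) →
      stateAt x' π = stateAt x π
  | [], _, _ => rfl
  | b :: π, h, h' => by
    have ih := stateAt_eq_of_mem_box_of_mem_box hT π
      (fun i hi => box_step_subset _ _ _ _ (h i hi))
      (fun i hi => box_step_subset _ _ _ _ (h' i hi))
    simp only [stateAt] at h h' ⊢
    rw [ih] at h' ⊢
    have hne : ∀ i, x i (Fin.ofNat d π.length) ≠ x' i (Fin.ofNat d π.length) → i ∈ T := by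
      intro i hi
      by_contra hiT
      exact hi (by rw [hT i hiT])
    -- The points of T lie beyond the median of their own configuration, on the same side in both,
    -- and the other points agree.
    have hs : (stateAt x π).split x' π.length = (stateAt x π).split x π.length := by
      symm
      cases b
      · exact median_eq_of_above (fun i _ hi => split_lt_of_mem_box (h i (hne i hi)))
          (fun i _ hi => split_lt_of_mem_box (h' i (hne i hi)))
      · exact median_eq_of_below (fun i _ hi => lt_split_of_mem_box (h i (hne i hi)))
          (fun i _ hi => lt_split_of_mem_box (h' i (hne i hi)))
    refine step_congr b hs fun i _ => ?_
    by_cases hi : i ∈ T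
    · cases b
      · have h1 := split_lt_of_mem_box (h i hi)
        have h2 := split_lt_of_mem_box (h' i hi)
        rw [hs] at h2
        exact iff_of_false (not_le.2 h1) (not_le.2 h2)
      · have h1 := lt_split_of_mem_box (h i hi)
        have h2 := lt_split_of_mem_box (h' i hi)
        rw [hs] at h2
        exact iff_of_true h1.le h2.le
    · rw [hT i hi]

theorem measurable_median (A : Finset ι) (a : Fin d) :
    Measurable fun x : ι → Fin d → ℝ => median A fun i => x i a := by
  rcases A.eq_empty_or_nonempty with rfl | hA
  · simp [median]
  refine measurable_of_Iic fun t => ?_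
  have : (fun x : ι → Fin d → ℝ => median A fun i => x i a) ⁻¹' Set.Iic t =
      {x | (A.card + 1) / 2 ≤ (A.filter (fun i => x i a ≤ t)).card} := by
    ext x; exact median_le_iff hA
  rw [this]
  refine measurableSet_le measurable_const (measurable_card_filter A (fun i (x : ι → Fin d → ℝ) => x i a ≤ t) ?_)
  exact fun i => measurableSet_le (by fun_prop) measurable_const

/-- The index set of a node takes finitely many values; on each piece it is constant, so
measurability reduces to a fixed set. -/
theorem measurable_of_finset_cases {Ω : Type*} [MeasurableSpace Ω] {S : Ω → Finset ι}
    (hS : ∀ A, MeasurableSet {ω | S ω = A}) {f : Finset ι → Ω → ℝ} (hf : ∀ A, Measurable (f A)) :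
    Measurable fun ω => f (S ω) ω := by
  intro B hB
  have : (fun ω => f (S ω) ω) ⁻¹' B = ⋃ A, {ω | S ω = A} ∩ f A ⁻¹' B := by
    ext ω; simp
  rw [this]
  exact MeasurableSet.iUnion fun A => (hS A).inter (hf A hB)

theorem measurableSet_of_finset_cases {Ω : Type*} [MeasurableSpace Ω] {S : Ω → Finset ι}
    (hS : ∀ A, MeasurableSet {ω | S ω = A}) {p : Finset ι → Ω → Prop}
    (hp : ∀ A, MeasurableSet {ω | p A ω}) : MeasurableSet {ω | p (S ω) ω} := by
  have : {ω | p (S ω) ω} = ⋃ A, {ω | S ω = A} ∩ {ω | p A ω} := by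
    ext ω; simp
  rw [this]
  exact MeasurableSet.iUnion fun A => (hS A).inter (hp A)

theorem measurableSet_filter_eq {Ω : Type*} [MeasurableSpace Ω] (A A' : Finset ι)
    (p : ι → Ω → Prop) [∀ i ω, Decidable (p i ω)] (hp : ∀ i, MeasurableSet {ω | p i ω}) :
    MeasurableSet {ω | (A.filter fun i => p i ω) = A'} := by
  have : {ω | (A.filter fun i => p i ω) = A'} = ⋂ i, {ω | (i ∈ A ∧ p i ω) ↔ i ∈ A'} := by
    ext ω; simp [Finset.ext_iff]
  rw [this]
  refine MeasurableSet.iInter fun i => ?_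
  by_cases h1 : i ∈ A <;> by_cases h2 : i ∈ A' <;> simp only [h1, h2, true_and, false_and, iff_true,
    iff_false, iff_self, MeasurableSet.univ, Set.ofPred_true, Set.ofPred_false,
    MeasurableSet.empty, hp i]
  · exact (hp i).compl

theorem measurable_stateAt : ∀ π : List Bool,
    (∀ A, MeasurableSet {x : ι → Fin d → ℝ | (stateAt x π).S = A}) ∧
    (∀ a, Measurable fun x : ι → Fin d → ℝ => (stateAt x π).lo a) ∧
    (∀ a, Measurable fun x : ι → Fin d → ℝ => (stateAt x π).hi a) ∧
    (∀ l, Measurable fun x : ι → Fin d → ℝ => (stateAt x π).split x l) := by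
  have hsplit : ∀ π : List Bool,
      (∀ A, MeasurableSet {x : ι → Fin d → ℝ | (stateAt x π).S = A}) →
      ∀ l, Measurable fun x : ι → Fin d → ℝ => (stateAt x π).split x l := fun π h l =>
    measurable_of_finset_cases h fun A => measurable_median A _
  intro π
  induction π with
  | nil =>
    have : ∀ A, MeasurableSet {x : ι → Fin d → ℝ | (stateAt x []).S = A} := fun A =>
      MeasurableSet.const (Finset.univ = A)
    exact ⟨this, fun _ => measurable_const, fun _ => measurable_const, hsplit _ this⟩
  | cons b π ih =>
    obtain ⟨hS, hlo, hhi, hsp⟩ := ih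
    have hm : ∀ i, MeasurableSet {x : ι → Fin d → ℝ |
        x i (Fin.ofNat d π.length) ≤ (stateAt x π).split x π.length} := fun i =>
      measurableSet_le (by fun_prop) (hsp _)
    have : ∀ A, MeasurableSet {x : ι → Fin d → ℝ | (stateAt x (b :: π)).S = A} := by
      intro A
      cases b <;> simp only [stateAt, step, Bool.false_eq_true, if_true, if_false]
      · exact measurableSet_of_finset_cases (p := fun B x => (B.filter fun i =>
          ¬ x i (Fin.ofNat d π.length) ≤ (stateAt x π).split x π.length) = A) hS
          fun B => measurableSet_filter_eq B A _ fun i => (hm i).compl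
      · exact measurableSet_of_finset_cases (p := fun B x => (B.filter fun i =>
          x i (Fin.ofNat d π.length) ≤ (stateAt x π).split x π.length) = A) hS
          fun B => measurableSet_filter_eq B A _ hm
    refine ⟨this, fun a => ?_, fun a => ?_, hsplit _ this⟩
    · cases b <;> simp only [stateAt, step, Bool.false_eq_true, if_true, if_false]
      · split_ifs
        · exact (hlo a).max (hsp _)
        · exact hlo a
      · exact hlo a
    · cases b <;> simp only [stateAt, step, Bool.false_eq_true, if_true, if_false]
      · exact hhi a
      · split_ifs
        · exact (hhi a).min (hsp _)
        · exact hhi a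

open Classical in
/-- The points of a node that lie in its open cell. -/
noncomputable def interiorPts (x : ι → Fin d → ℝ) (π : List Bool) : Finset ι :=
  (stateAt x π).S.filter fun i => x i ∈ (stateAt x π).box

theorem measurableSet_mem_box (π : List Bool) (i : ι) :
    MeasurableSet {x : ι → Fin d → ℝ | x i ∈ (stateAt x π).box} := by
  simp only [mem_box, Set.ofPred_forall]
  exact MeasurableSet.iInter fun a =>
    (measurableSet_lt ((measurable_stateAt π).2.1 a) (by fun_prop)).inter
      (measurableSet_lt (by fun_prop) ((measurable_stateAt π).2.2.1 a))

theorem measurableSet_interiorPts_eq (π : List Bool) (T : Finset ι) :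
    MeasurableSet {x : ι → Fin d → ℝ | interiorPts x π = T} := by
  classical
  exact measurableSet_of_finset_cases (p := fun B x => (B.filter fun i =>
    x i ∈ (stateAt x π).box) = T) (measurable_stateAt π).1
    fun B => measurableSet_filter_eq B T _ (measurableSet_mem_box π)

end KdTree

/-! ### Hoeffding's inequality, conditioning and uniform measure on boxes -/

namespace KdTree

section Sampling

variable {E : Type*} [MeasurableSpace E] {J : Type*} [Fintype J]

open Classical in
theorem hoeffding_pi (κ : Measure E) [IsProbabilityMeasure κ] {A : Set E} (hA : MeasurableSet A)
    {δ : ℝ} (hδ : 0 ≤ δ) :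
    (Measure.pi fun _ : J => κ).real {z | κ.real A * Fintype.card J + δ ≤
      ((Finset.univ.filter fun j => z j ∈ A).card : ℝ)} ≤
      Real.exp (-2 * δ ^ 2 / Fintype.card J) := by
  have hm : Measurable (A.indicator fun _ => (1 : ℝ)) := measurable_const.indicator hA
  have hmean : ∫ y, A.indicator (fun _ => (1 : ℝ)) y ∂κ = κ.real A := by
    simp [integral_indicator hA]
  have hsub : HasSubgaussianMGF (fun y => A.indicator (fun _ => (1 : ℝ)) y - κ.real A)
      ((‖(1 : ℝ) - 0‖₊ / 2) ^ 2) κ := by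
    rw [← hmean]
    refine hasSubgaussianMGF_of_mem_Icc hm.aemeasurable (Filter.Eventually.of_forall fun y => ?_)
    by_cases hy : y ∈ A <;> simp [hy]
  have hind : iIndepFun (fun (j : J) (z : J → E) =>
      A.indicator (fun _ => (1 : ℝ)) (z j) - κ.real A) (Measure.pi fun _ : J => κ) :=
    iIndepFun_pi (X := fun _ y => A.indicator (fun _ => (1 : ℝ)) y - κ.real A)
      (fun _ => (hm.sub_const _).aemeasurable)
  have hsub' : ∀ j ∈ (Finset.univ : Finset J), HasSubgaussianMGF (fun z : J → E =>
      A.indicator (fun _ => (1 : ℝ)) (z j) - κ.real A) ((‖(1 : ℝ) - 0‖₊ / 2) ^ 2)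
      (Measure.pi fun _ : J => κ) := by
    intro j _
    have hp := measurePreserving_eval (fun _ : J => κ) j
    refine HasSubgaussianMGF.of_map (Y := Function.eval j)
      (X := fun y => A.indicator (fun _ => (1 : ℝ)) y - κ.real A) hp.measurable.aemeasurable ?_
    rwa [hp.map_eq]
  have h := HasSubgaussianMGF.measure_sum_ge_le_of_iIndepFun hind hsub' hδ
  have hset : {z : J → E | κ.real A * Fintype.card J + δ ≤
      ((Finset.univ.filter fun j => z j ∈ A).card : ℝ)} =
      {z | δ ≤ ∑ j, (A.indicator (fun _ => (1 : ℝ)) (z j) - κ.real A)} := by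
    ext z
    have : ((Finset.univ.filter fun j => z j ∈ A).card : ℝ) =
        ∑ j, A.indicator (fun _ => (1 : ℝ)) (z j) := by
      rw [Finset.card_filter]; push_cast
      exact Finset.sum_congr rfl fun j _ => by simp [Set.indicator_apply]
    simp only [Set.mem_ofPred_eq, this, Finset.sum_sub_distrib, Finset.sum_const, Finset.card_univ,
      nsmul_eq_mul]
    constructor <;> intro h <;> linarith
  rw [hset]
  refine h.trans (le_of_eq ?_)
  congr 1
  simp only [Finset.sum_const, Finset.card_univ, nsmul_eq_mul]
  push_cast
  -- For empty `J` both exponents are divisions by zero, hence 0.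
  rcases Nat.eq_zero_or_pos (Fintype.card J) with h0 | h0
  · simp [h0]
  · simp
    field_simp

open Classical in
/-- Hoeffding's inequality for points conditioned to lie in a set `B`. -/
theorem hoeffding_pi_inter (μ : Measure E) [IsProbabilityMeasure μ] {A B : Set E}
    (hA : MeasurableSet A) (hB : MeasurableSet B) {p δ : ℝ} (hp : 0 ≤ p) (hδ : 0 ≤ δ)
    (hAB : μ (A ∩ B) = ENNReal.ofReal p * μ B) :
    Measure.pi (fun _ : J => μ) {z | (∀ j, z j ∈ B) ∧ p * Fintype.card J + δ ≤
      ((Finset.univ.filter fun j => z j ∈ A).card : ℝ)} ≤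
      ENNReal.ofReal (Real.exp (-2 * δ ^ 2 / Fintype.card J)) *
        Measure.pi (fun _ : J => μ) {z | ∀ j, z j ∈ B} := by
  have hBset : {z : J → E | ∀ j, z j ∈ B} = Set.univ.pi fun _ => B := by ext z; simp
  rcases eq_or_ne (μ B) 0 with h0 | h0
  · rcases isEmpty_or_nonempty J with hJ | hJ
    · refine le_trans (measure_mono (t := {z : J → E | ∀ j, z j ∈ B}) fun z hz => hz.1) ?_
      simp
    · refine le_trans (measure_mono (t := {z : J → E | ∀ j, z j ∈ B}) fun z hz => hz.1) ?_
      have : Measure.pi (fun _ : J => μ) {z | ∀ j, z j ∈ B} = 0 := by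
        rw [hBset, Measure.pi_pi]; simp [h0]
      rw [this]; simp
  have hBtop : μ B ≠ ⊤ := measure_ne_top _ _
  have hκ : IsProbabilityMeasure (cond μ B) := cond_isProbabilityMeasure h0
  have hreal : (cond μ B).real A = p := by
    rw [measureReal_def, cond_apply hB, Set.inter_comm, hAB, mul_comm, mul_assoc,
      ENNReal.mul_inv_cancel h0 hBtop, mul_one, ENNReal.toReal_ofReal hp]
  -- Restricting the product measure to the power of `B` is conditioning each coordinate, up to the
  -- total mass; this reduces the claim to the unconditioned inequality.
  have hpi : Measure.pi (fun _ : J => μ.restrict B) =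
      (μ B) ^ Fintype.card J • Measure.pi (fun _ : J => cond μ B) := by
    refine Measure.pi_eq fun s hs => ?_
    rw [Measure.smul_apply, Measure.pi_pi, smul_eq_mul, ← Finset.card_univ, ← Finset.prod_const,
      ← Finset.prod_mul_distrib]
    refine Finset.prod_congr rfl fun j _ => ?_
    rw [ProbabilityTheory.cond, Measure.smul_apply, smul_eq_mul, ← mul_assoc, ENNReal.mul_inv_cancel h0 hBtop, one_mul]
  set D : Set (J → E) := {z | p * Fintype.card J + δ ≤
      ((Finset.univ.filter fun j => z j ∈ A).card : ℝ)} with hD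
  have hsplit : {z : J → E | (∀ j, z j ∈ B) ∧ p * Fintype.card J + δ ≤
      ((Finset.univ.filter fun j => z j ∈ A).card : ℝ)} = D ∩ Set.univ.pi fun _ => B := by
    ext z; simp [hD, and_comm]
  rw [hsplit, hBset, ← Measure.restrict_apply' (MeasurableSet.univ_pi fun _ => hB),
    Measure.restrict_pi_pi, hpi, Measure.smul_apply, smul_eq_mul, Measure.pi_pi,
    Finset.prod_const, Finset.card_univ, mul_comm]
  gcongr
  have := hoeffding_pi (J := J) (cond μ B) hA hδ
  rw [hreal] at this
  rw [← ENNReal.ofReal_toReal (measure_ne_top (Measure.pi fun _ : J => cond μ B) D)]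
  exact ENNReal.ofReal_le_ofReal this

open Classical in
/-- Conditioning on the coordinates outside `T`. -/
theorem measure_pi_le_of_section_le {ι : Type*} [Fintype ι] (μ : Measure E) [IsProbabilityMeasure μ]
    (T : Finset ι) {F G : Set (ι → E)} (hF : MeasurableSet F) (hG : MeasurableSet G)
    {β : ENNReal} (hβ : β ≠ ⊤)
    (h : ∀ x : ι → E, Measure.pi (fun _ : T => μ)
        {z | (fun i => if hi : i ∈ T then z ⟨i, hi⟩ else x i) ∈ F} ≤
      β * Measure.pi (fun _ : T => μ)
        {z | (fun i => if hi : i ∈ T then z ⟨i, hi⟩ else x i) ∈ G}) :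
    Measure.pi (fun _ : ι => μ) F ≤ β * Measure.pi (fun _ : ι => μ) G := by
  -- The hypothesis takes a configuration on all of `ι`, whose coordinates in `T` are overwritten;
  -- any point `e₀` serves as filler there.
  rcases isEmpty_or_nonempty E with hE | ⟨⟨e₀⟩⟩
  · exact absurd (measure_univ (μ := μ)) (by simp [Set.univ_eq_empty_iff.2 hE])
  set e := MeasurableEquiv.piEquivPiSubtypeProd (fun _ : ι => E) (· ∈ T) with he
  have hmp := (measurePreserving_piEquivPiSubtypeProd (fun _ : ι => μ) (· ∈ T)).symm e
  have hform : ∀ (z : T → E) (y : {i // i ∉ T} → E), e.symm (z, y) =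
      fun i => if hi : i ∈ T then z ⟨i, hi⟩ else (if hi : i ∈ T then e₀ else y ⟨i, hi⟩) := by
    intro z y
    funext i
    by_cases hi : i ∈ T <;> simp [he, MeasurableEquiv.piEquivPiSubtypeProd,
      Equiv.piEquivPiSubtypeProd, hi]
  have key : ∀ H : Set (ι → E), MeasurableSet H → Measure.pi (fun _ : ι => μ) H =
      ∫⁻ y, Measure.pi (fun _ : T => μ) {z | e.symm (z, y) ∈ H}
        ∂(Measure.pi fun _ : {i // i ∉ T} => μ) := by
    intro H hH
    rw [← hmp.measure_preimage hH.nullMeasurableSet,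
      Measure.prod_apply_symm (e.symm.measurable hH)]
    refine lintegral_congr fun y => ?_
    congr!
  rw [key F hF, key G hG, ← lintegral_const_mul' _ _ hβ]
  refine lintegral_mono fun y => ?_
  simp only [hform]
  exact h _

end Sampling

section Box

variable {d : ℕ}

theorem volume_pi_update (I : Fin d → Set ℝ) (a : Fin d) (K : Set ℝ) (c : ENNReal)
    (h : volume K = c * volume (I a)) :
    volume (Set.univ.pi (Function.update I a K)) = c * volume (Set.univ.pi I) := by
  rw [volume_pi_pi, volume_pi_pi, ← Finset.mul_prod_erase _ _ (Finset.mem_univ a),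
    ← Finset.mul_prod_erase _ (fun i => volume (I i)) (Finset.mem_univ a), ← mul_assoc,
    Function.update_self, h]
  congr 1
  refine Finset.prod_congr rfl fun i hi => ?_
  rw [Function.update_of_ne (Finset.ne_of_mem_erase hi)]

theorem inter_pi_eq_pi_update (I : Fin d → Set ℝ) (a : Fin d) (K : Set ℝ) :
    {y : Fin d → ℝ | y a ∈ K} ∩ Set.univ.pi I =
      Set.univ.pi (Function.update I a (K ∩ I a)) := by
  ext y
  simp only [Set.mem_inter_iff, Set.mem_ofPred_eq, Set.mem_univ_pi]
  constructor
  · rintro ⟨h1, h2⟩ i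
    rcases eq_or_ne i a with rfl | hi
    · rw [Function.update_self]; exact ⟨h1, h2 i⟩
    · rw [Function.update_of_ne hi]; exact h2 i
  · intro h
    have ha := h a
    rw [Function.update_self] at ha
    refine ⟨ha.1, fun i => ?_⟩
    rcases eq_or_ne i a with rfl | hi
    · exact ha.2
    · have := h i; rwa [Function.update_of_ne hi] at this

/-- The uniform distribution on the unit cube, in coordinates. -/
noncomputable def unitLaw (d : ℕ) : Measure (Fin d → ℝ) :=
  volume.restrict (Set.univ.pi fun _ => Set.Icc (0 : ℝ) 1)

instance : IsProbabilityMeasure (unitLaw d) :=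
  ⟨by rw [unitLaw, Measure.restrict_apply MeasurableSet.univ, Set.univ_inter, volume_pi_pi]; simp⟩

theorem unitLaw_apply_of_subset {s : Set (Fin d → ℝ)}
    (h : s ⊆ Set.univ.pi fun _ => Set.Icc (0 : ℝ) 1) : unitLaw d s = volume s := by
  rw [unitLaw, Measure.restrict_apply' (MeasurableSet.univ_pi fun _ => measurableSet_Icc),
    Set.inter_eq_left.2 h]

theorem measurableSet_box {ι : Type*} (σ : State d ι) : MeasurableSet σ.box :=
  MeasurableSet.univ_pi fun _ => measurableSet_Ioo

variable [NeZero d] {ι : Type*} [Fintype ι]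

theorem stateAt_box_subset (x : ι → Fin d → ℝ) : ∀ π : List Bool,
    (stateAt x π).box ⊆ Set.univ.pi fun _ => Set.Icc (0 : ℝ) 1
  | [] => Set.pi_mono fun _ _ => Set.Ioo_subset_Icc_self
  | _ :: π => (State.box_step_subset _ _ _ _).trans (stateAt_box_subset x π)

end Box

end KdTree

/-! ### Concentration of the median of one node -/

namespace KdTree

variable {d : ℕ} [NeZero d] {ι : Type*} [Fintype ι]

/-- The split of the node at the end of `π` is off the centre of its cell by more than the
fraction `ε` of the side length, although the node holds `2 h` points of which at most `e` lie on
the boundary of the cell. -/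
def Unbalanced (x : ι → Fin d → ℝ) (π : List Bool) (h e : ℕ) (ε : ℝ) : Prop :=
  (stateAt x π).S.card = 2 * h ∧ (stateAt x π).S.card ≤ (interiorPts x π).card + e ∧
  (stateAt x π).lo (Fin.ofNat d π.length) < (stateAt x π).hi (Fin.ofNat d π.length) ∧
  ((stateAt x π).split x π.length < (stateAt x π).lo (Fin.ofNat d π.length) + (1 / 2 - ε) *
      ((stateAt x π).hi (Fin.ofNat d π.length) - (stateAt x π).lo (Fin.ofNat d π.length)) ∨
    (stateAt x π).hi (Fin.ofNat d π.length) - (1 / 2 - ε) *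
      ((stateAt x π).hi (Fin.ofNat d π.length) - (stateAt x π).lo (Fin.ofNat d π.length)) <
    (stateAt x π).split x π.length)

theorem measurableSet_unbalanced (π : List Bool) (h e : ℕ) (ε : ℝ) :
    MeasurableSet {x : ι → Fin d → ℝ | Unbalanced x π h e ε} := by
  obtain ⟨hS, hlo, hhi, hsp⟩ := measurable_stateAt (d := d) (ι := ι) π
  refine (measurableSet_of_finset_cases (p := fun A _ => A.card = 2 * h) hS
    fun A => MeasurableSet.const _).inter (MeasurableSet.inter ?_ (MeasurableSet.inter ?_
      (MeasurableSet.union ?_ ?_)))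
  · exact measurableSet_of_finset_cases (p := fun A x => A.card ≤ (interiorPts x π).card + e) hS
      fun A => measurableSet_of_finset_cases (p := fun T _ => A.card ≤ T.card + e)
        (measurableSet_interiorPts_eq π) fun T => MeasurableSet.const _
  · exact measurableSet_lt (hlo _) (hhi _)
  · exact measurableSet_lt (hsp _) ((hlo _).add (((hhi _).sub (hlo _)).const_mul _))
  · exact measurableSet_lt ((hhi _).sub (((hhi _).sub (hlo _)).const_mul _)) (hsp _)

open Classical in
theorem interiorPts_subset (x : ι → Fin d → ℝ) (π : List Bool) :
    interiorPts x π ⊆ (stateAt x π).S := Finset.filter_subset _ _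

open Classical in
theorem mem_box_of_mem_interiorPts {x : ι → Fin d → ℝ} {π : List Bool} {i : ι}
    (hi : i ∈ interiorPts x π) : x i ∈ (stateAt x π).box := (Finset.mem_filter.1 hi).2

open Classical in
theorem interiorPts_eq_of_stateAt_eq {x x' : ι → Fin d → ℝ} {π : List Bool}
    (hs : stateAt x' π = stateAt x π)
    (hx : ∀ i ∉ interiorPts x π, x i = x' i)
    (hx' : ∀ i ∈ interiorPts x π, x' i ∈ (stateAt x π).box) :
    interiorPts x' π = interiorPts x π := by
  ext i
  by_cases hi : i ∈ interiorPts x π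
  · simp only [hi, iff_true]
    refine Finset.mem_filter.2 ⟨?_, ?_⟩
    · rw [hs]; exact interiorPts_subset _ _ hi
    · rw [hs]; exact hx' i hi
  · simp only [hi, iff_false]
    intro hi'
    apply hi
    have := Finset.mem_filter.1 hi'
    rw [hs, ← hx i hi] at this
    exact Finset.mem_filter.2 this

open Classical in
-- A median inside an outer slab forces at least h of the 2h points into that slab; at most e of
-- them are not interior.
theorem Unbalanced.card_filter {x : ι → Fin d → ℝ} {π : List Bool} {h e : ℕ} {ε : ℝ} (hh : 0 < h)
    (hx : Unbalanced x π h e ε) :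
    (h ≤ ((interiorPts x π).filter fun i => x i (Fin.ofNat d π.length) ≤
      (stateAt x π).lo (Fin.ofNat d π.length) + (1 / 2 - ε) *
      ((stateAt x π).hi (Fin.ofNat d π.length) - (stateAt x π).lo (Fin.ofNat d π.length))).card + e) ∨
    (h ≤ ((interiorPts x π).filter fun i => (stateAt x π).hi (Fin.ofNat d π.length) - (1 / 2 - ε) *
      ((stateAt x π).hi (Fin.ofNat d π.length) - (stateAt x π).lo (Fin.ofNat d π.length)) ≤
      x i (Fin.ofNat d π.length)).card + e) := by
  obtain ⟨hc, he, -, hs⟩ := hx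
  set S := (stateAt x π).S
  set T := interiorPts x π
  have hS : S.Nonempty := Finset.card_pos.1 (by omega)
  have hsd : (S \ T).card ≤ e := by
    rw [Finset.card_sdiff_of_subset (interiorPts_subset x π)]
    change S.card - T.card ≤ e
    omega
  have hcount : ∀ p q : ι → Prop, (∀ i, p i → q i) →
      (S.filter p).card ≤ (T.filter q).card + e := by
    intro p q hpq
    refine le_trans (le_trans (Finset.card_le_card (t := T.filter q ∪ (S \ T)) fun i hi => ?_)
      (Finset.card_union_le _ _)) (Nat.add_le_add_left hsd _)
    obtain ⟨h1, h2⟩ := Finset.mem_filter.1 hi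
    by_cases hT : i ∈ T
    · exact Finset.mem_union_left _ (Finset.mem_filter.2 ⟨hT, hpq i h2⟩)
    · exact Finset.mem_union_right _ (Finset.mem_sdiff.2 ⟨h1, hT⟩)
  rcases hs with hs | hs
  · left
    have h1 : (2 * h + 1) / 2 ≤ (S.filter fun i => x i (Fin.ofNat d π.length) ≤
        (stateAt x π).split x π.length).card := by
      rw [← hc]; exact le_card_filter_le_median hS
    refine le_trans (by omega) (hcount (fun i => x i (Fin.ofNat d π.length) ≤
      (stateAt x π).split x π.length) _ fun i hi => hi.trans hs.le)
  · right
    have h1 : (S.filter fun i => x i (Fin.ofNat d π.length) <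
        (stateAt x π).split x π.length).card < (2 * h + 1) / 2 := by
      rw [← hc]; exact card_filter_lt_median hS
    have h2 := Finset.card_filter_add_card_filter_not (s := S) (fun i => x i (Fin.ofNat d π.length) <
      (stateAt x π).split x π.length)
    have hc' : S.card = 2 * h := hc
    have h3 : h ≤ (S.filter fun i => ¬ x i (Fin.ofNat d π.length) <
      (stateAt x π).split x π.length).card := by omega
    refine le_trans (h3.trans_eq ?_) (hcount (fun i => ¬ x i (Fin.ofNat d π.length) <
      (stateAt x π).split x π.length) _ fun i hi => hs.le.trans (not_lt.1 hi))
    congr!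

theorem unitLaw_inter_box {σ : State d ι} (hσ : σ.box ⊆ Set.univ.pi fun _ => Set.Icc (0 : ℝ) 1)
    (a : Fin d) {p : ℝ} {K : Set ℝ} (hp : 0 ≤ p)
    (hK : volume (K ∩ Set.Ioo (σ.lo a) (σ.hi a)) = ENNReal.ofReal (p * (σ.hi a - σ.lo a))) :
    unitLaw d ({y | y a ∈ K} ∩ σ.box) = ENNReal.ofReal p * unitLaw d σ.box := by
  rw [unitLaw_apply_of_subset hσ, unitLaw_apply_of_subset (Set.inter_subset_right.trans hσ),
    State.box, inter_pi_eq_pi_update, volume_pi_update]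
  rw [hK, Real.volume_Ioo, ENNReal.ofReal_mul hp]

/-- A slab of relative width 1/2 - ε expects at most h - 2hε of the N ≤ 2h interior points, so
holding h - e of them is a deviation of at least 2hε - e ≥ hε. -/
theorem two_mul_hoeffding_exponent_le {N h e : ℕ} {ε : ℝ} (hN : N ≤ 2 * h) (hN0 : 0 < N)
    (hε : 0 ≤ ε) (he : (e : ℝ) ≤ h * ε) :
    Real.exp (-2 * (2 * h * ε - e) ^ 2 / N) ≤ Real.exp (-(h * ε ^ 2)) := by
  rw [Real.exp_le_exp]
  have hN' : (N : ℝ) ≤ 2 * h := by exact_mod_cast hN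
  have hN0' : (0 : ℝ) < N := by exact_mod_cast hN0
  have h1 : ((h : ℝ) * ε) ^ 2 ≤ (2 * h * ε - e) ^ 2 :=
    pow_le_pow_left₀ (by positivity) (by linarith) 2
  rw [div_le_iff₀ hN0']
  have h2 : (h : ℝ) * ε ^ 2 * N ≤ h * ε ^ 2 * (2 * h) := by gcongr
  nlinarith

/-- With the points outside `T` frozen, the cell does not depend on the points of `T`, and Hoeffding
applies to each of the two outer slabs; hence the factor 2. -/
theorem measure_unbalanced_inter_le (π : List Bool) {h e : ℕ} {ε : ℝ} (hh : 0 < h) (hε : 0 ≤ ε)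
    (hε' : ε ≤ 1 / 2) (he : (e : ℝ) ≤ h * ε) (he' : e < 2 * h) (T : Finset ι) :
    Measure.pi (fun _ : ι => unitLaw d)
      ({x | Unbalanced x π h e ε} ∩ {x | interiorPts x π = T}) ≤
      ENNReal.ofReal (2 * Real.exp (-(h * ε ^ 2))) *
        Measure.pi (fun _ : ι => unitLaw d) {x | interiorPts x π = T} := by
  classical
  refine measure_pi_le_of_section_le _ T ((measurableSet_unbalanced π h e ε).inter
    (measurableSet_interiorPts_eq π T)) (measurableSet_interiorPts_eq π T) ENNReal.ofReal_ne_top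
    fun y => ?_
  set m : (T → Fin d → ℝ) → ι → Fin d → ℝ := fun z i => if hi : i ∈ T then z ⟨i, hi⟩ else y i
    with hm
  have hmT : ∀ z (j : T), m z j = z j := fun z j => by simp [hm]
  have hmT' : ∀ z (i : ι) (hi : i ∈ T), m z i = z ⟨i, hi⟩ := fun z i hi => by simp [hm, hi]
  have hmc : ∀ z z', ∀ i ∉ (T : Set ι), m z i = m z' i := fun z z' i hi => by
    have hi : i ∉ T := hi
    simp [hm, hi]
  -- A section without bad configurations is trivial; otherwise one bad `z₀` supplies the reference
  -- cell `σ`.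
  rcases Set.eq_empty_or_nonempty {z | m z ∈ {x | Unbalanced x π h e ε} ∩
    {x | interiorPts x π = T}} with h0 | ⟨z₀, hz₀⟩
  · change Measure.pi (fun _ : T => unitLaw d) {z | m z ∈ {x | Unbalanced x π h e ε} ∩
      {x | interiorPts x π = T}} ≤ _
    rw [h0]; simp
  obtain ⟨hU, hz₀T⟩ := hz₀
  have hz₀T : interiorPts (m z₀) π = T := hz₀T
  set σ := stateAt (m z₀) π with hσ
  have hstate : ∀ z, interiorPts (m z) π = T → stateAt (m z) π = σ := fun z hz =>
    stateAt_eq_of_mem_box_of_mem_box (hmc z₀ z) π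
      (fun i hi => mem_box_of_mem_interiorPts (hz₀T.symm ▸ hi))
      (fun i hi => mem_box_of_mem_interiorPts (hz.symm ▸ hi))
  -- The conditioning event is exactly a power of the fixed box: one direction compares two
  -- configurations that both have T interior, the other moves points inside the box of `z₀`.
  have hiff : ∀ z, interiorPts (m z) π = T ↔ ∀ j, z j ∈ σ.box := by
    intro z
    constructor
    · intro hz j
      rw [← hstate z hz, ← hmT z j]
      exact mem_box_of_mem_interiorPts (hz.symm ▸ j.2)
    · intro hz
      have hbox : ∀ i ∈ (T : Set ι), m z i ∈ σ.box := fun i hi => by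
        rw [hmT' z i hi]; exact hz _
      have hst : stateAt (m z) π = σ := stateAt_eq_of_mem_box (hmc z₀ z) π
        (fun i hi => mem_box_of_mem_interiorPts (hz₀T.symm ▸ hi)) hbox
      rw [interiorPts_eq_of_stateAt_eq hst (fun i hi => hmc z₀ z i (by rwa [hz₀T] at hi))
        (fun i hi => hbox i (by rwa [hz₀T] at hi)), hz₀T]
  have hlohi : σ.lo (Fin.ofNat d π.length) < σ.hi (Fin.ofNat d π.length) := hU.2.2.1
  have hTc : T.card ≤ 2 * h := by
    rw [← hU.1, ← hz₀T]; exact Finset.card_le_card (interiorPts_subset _ _)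
  have hT0 : 0 < T.card := by
    have h1 := hU.1
    have h2 := hU.2.1
    rw [hz₀T] at h2
    omega
  set a : Fin d := Fin.ofNat d π.length with ha
  set w := σ.hi a - σ.lo a with hw
  have hw0 : 0 < w := sub_pos.2 hlohi
  have hσ1 : σ.box ⊆ Set.univ.pi fun _ => Set.Icc (0 : ℝ) 1 := stateAt_box_subset _ _
  have hp : 0 ≤ 1 / 2 - ε := by linarith
  have hpw : 0 ≤ (1 / 2 - ε) * w := mul_nonneg hp hw0.le
  have hpw' : (1 / 2 - ε) * w < w := by nlinarith
  set A₁ : Set (Fin d → ℝ) := {y | y a ∈ Set.Iic (σ.lo a + (1 / 2 - ε) * w)} with hA₁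
  set A₂ : Set (Fin d → ℝ) := {y | y a ∈ Set.Ici (σ.hi a - (1 / 2 - ε) * w)} with hA₂
  have hv₁ : unitLaw d (A₁ ∩ σ.box) = ENNReal.ofReal (1 / 2 - ε) * unitLaw d σ.box := by
    refine unitLaw_inter_box hσ1 a hp ?_
    have : Set.Iic (σ.lo a + (1 / 2 - ε) * w) ∩ Set.Ioo (σ.lo a) (σ.hi a) =
        Set.Ioc (σ.lo a) (σ.lo a + (1 / 2 - ε) * w) := by
      ext t
      simp only [Set.mem_inter_iff, Set.mem_Iic, Set.mem_Ioo, Set.mem_Ioc]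
      exact ⟨fun h => ⟨h.2.1, h.1⟩, fun h => ⟨h.2, h.1, by linarith [h.2]⟩⟩
    rw [this, Real.volume_Ioc, add_sub_cancel_left]
  have hv₂ : unitLaw d (A₂ ∩ σ.box) = ENNReal.ofReal (1 / 2 - ε) * unitLaw d σ.box := by
    refine unitLaw_inter_box hσ1 a hp ?_
    have : Set.Ici (σ.hi a - (1 / 2 - ε) * w) ∩ Set.Ioo (σ.lo a) (σ.hi a) =
        Set.Ico (σ.hi a - (1 / 2 - ε) * w) (σ.hi a) := by
      ext t
      simp only [Set.mem_inter_iff, Set.mem_Ici, Set.mem_Ioo, Set.mem_Ico]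
      exact ⟨fun h => ⟨h.1, h.2.2⟩, fun h => ⟨h.1, by linarith [h.1], h.2⟩⟩
    rw [this, Real.volume_Ico, sub_sub_cancel]
  have hmA₁ : MeasurableSet A₁ := measurableSet_Iic.preimage (measurable_pi_apply a)
  have hmA₂ : MeasurableSet A₂ := measurableSet_Ici.preimage (measurable_pi_apply a)
  have hδ : 0 ≤ 2 * h * ε - e := by
    have : (0 : ℝ) ≤ h * ε := by positivity
    linarith
  have hbd : ∀ A : Set (Fin d → ℝ), MeasurableSet A →
      unitLaw d (A ∩ σ.box) = ENNReal.ofReal (1 / 2 - ε) * unitLaw d σ.box →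
      Measure.pi (fun _ : T => unitLaw d) {z | (∀ j, z j ∈ σ.box) ∧
        h ≤ (Finset.univ.filter fun j => z j ∈ A).card + e} ≤
      ENNReal.ofReal (Real.exp (-(h * ε ^ 2))) *
        Measure.pi (fun _ : T => unitLaw d) {z | ∀ j, z j ∈ σ.box} := by
    intro A hA hAv
    refine le_trans (measure_mono ?_) ((hoeffding_pi_inter (J := T) (unitLaw d) hA
      (measurableSet_box σ) hp hδ hAv).trans ?_)
    · rintro z ⟨hz1, hz2⟩
      refine ⟨hz1, ?_⟩
      have hz2' : (h : ℝ) ≤ ((Finset.univ.filter fun j => z j ∈ A).card : ℝ) + e := by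
        exact_mod_cast hz2
      have hTc' : (T.card : ℝ) ≤ 2 * h := by exact_mod_cast hTc
      rw [Fintype.card_coe]
      have := mul_le_mul_of_nonneg_left hTc' hp
      linarith
    · rw [Fintype.card_coe]
      gcongr
      exact Real.exp_le_exp.1 (two_mul_hoeffding_exponent_le hTc hT0 hε he)
  have hcard : ∀ z (A : Set (Fin d → ℝ)), (T.filter fun i => m z i ∈ A).card ≤
      (Finset.univ.filter fun j : T => z j ∈ A).card := by
    intro z A
    refine le_trans (Finset.card_le_card (t := (Finset.univ.filter fun j : T => z j ∈ A).image
      Subtype.val) fun i hi => ?_) Finset.card_image_le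
    obtain ⟨h1, h2⟩ := Finset.mem_filter.1 hi
    rw [hmT' z i h1] at h2
    exact Finset.mem_image.2 ⟨⟨i, h1⟩, Finset.mem_filter.2 ⟨Finset.mem_univ _, h2⟩, rfl⟩
  calc Measure.pi (fun _ : T => unitLaw d) {z | m z ∈ {x | Unbalanced x π h e ε} ∩
        {x | interiorPts x π = T}}
      ≤ Measure.pi (fun _ : T => unitLaw d) ({z | (∀ j, z j ∈ σ.box) ∧
        h ≤ (Finset.univ.filter fun j => z j ∈ A₁).card + e} ∪ {z | (∀ j, z j ∈ σ.box) ∧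
        h ≤ (Finset.univ.filter fun j => z j ∈ A₂).card + e}) := by
        refine measure_mono fun z hz => ?_
        obtain ⟨hz1, hz2⟩ := hz
        have hz2 : interiorPts (m z) π = T := hz2
        have hz1 : Unbalanced (m z) π h e ε := hz1
        have hb := (hiff z).1 hz2
        have := hz1.card_filter hh
        rw [hstate z hz2, hz2] at this
        rcases this with h1 | h1
        · exact Or.inl ⟨hb, h1.trans (Nat.add_le_add_right (hcard z A₁) e)⟩
        · exact Or.inr ⟨hb, h1.trans (Nat.add_le_add_right (hcard z A₂) e)⟩
    _ ≤ _ := measure_union_le _ _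
    _ ≤ _ := add_le_add (hbd A₁ hmA₁ hv₁) (hbd A₂ hmA₂ hv₂)
    _ = ENNReal.ofReal (2 * Real.exp (-(h * ε ^ 2))) *
        Measure.pi (fun _ : T => unitLaw d) {z | ∀ j, z j ∈ σ.box} := by
        rw [← add_mul, ← ENNReal.ofReal_add (Real.exp_nonneg _) (Real.exp_nonneg _), two_mul]
    _ = _ := by
        congr 2
        ext z
        exact (hiff z).symm

/-- The concentration of the median of a node about the centre of its cell. -/
theorem measure_unbalanced_le (π : List Bool) {h e : ℕ} {ε : ℝ} (hh : 0 < h) (hε : 0 ≤ ε)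
    (hε' : ε ≤ 1 / 2) (he : (e : ℝ) ≤ h * ε) (he' : e < 2 * h) :
    Measure.pi (fun _ : ι => unitLaw d) {x | Unbalanced x π h e ε} ≤
      ENNReal.ofReal (2 * Real.exp (-(h * ε ^ 2))) := by
  classical
  have hU : (⋃ T : Finset ι, {x : ι → Fin d → ℝ | interiorPts x π = T}) = Set.univ := by
    ext x; simp
  calc Measure.pi (fun _ : ι => unitLaw d) {x | Unbalanced x π h e ε}
      = Measure.pi (fun _ : ι => unitLaw d)
        (⋃ T : Finset ι, {x | Unbalanced x π h e ε} ∩ {x | interiorPts x π = T}) := by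
        rw [← Set.inter_iUnion, hU, Set.inter_univ]
    _ ≤ ∑ T : Finset ι, Measure.pi (fun _ : ι => unitLaw d)
        ({x | Unbalanced x π h e ε} ∩ {x | interiorPts x π = T}) := measure_iUnion_fintype_le _ _
    _ ≤ ∑ T : Finset ι, ENNReal.ofReal (2 * Real.exp (-(h * ε ^ 2))) *
        Measure.pi (fun _ : ι => unitLaw d) {x | interiorPts x π = T} :=
        Finset.sum_le_sum fun T _ => measure_unbalanced_inter_le π hh hε hε' he he' T
    _ = ENNReal.ofReal (2 * Real.exp (-(h * ε ^ 2))) *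
        Measure.pi (fun _ : ι => unitLaw d)
          (⋃ T : Finset ι, {x : ι → Fin d → ℝ | interiorPts x π = T}) := by
        rw [← Finset.mul_sum, measure_iUnion _ (measurableSet_interiorPts_eq π), tsum_fintype]
        intro T T' hTT'
        refine Set.disjoint_left.2 fun x hx hx' => hTT' ?_
        exact Eq.trans (Eq.symm hx) hx'
    _ = _ := by rw [hU, measure_univ, mul_one]

end KdTree

/-! ### General position and the geometry of balanced trees -/

namespace KdTree

variable {d : ℕ} [NeZero d] {ι : Type*} [Fintype ι]

/-- All points lie in the open unit cube and no two share a coordinate. -/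
structure InGeneralPosition (x : ι → Fin d → ℝ) : Prop where
  pos : ∀ i a, 0 < x i a
  lt_one : ∀ i a, x i a < 1
  injective : ∀ a, Function.Injective fun i => x i a

namespace InGeneralPosition

variable {x : ι → Fin d → ℝ}

/-- The upper inequality cannot be strict: the median point goes left and lies on the upper face it
creates. -/
theorem mem_cell (hx : InGeneralPosition x) : ∀ (π : List Bool), ∀ i ∈ (stateAt x π).S, ∀ a,
    (stateAt x π).lo a < x i a ∧ x i a ≤ (stateAt x π).hi a
  | [], i, _, a => ⟨hx.pos i a, (hx.lt_one i a).le⟩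
  | true :: π, i, hi, a => by
    simp only [stateAt, State.step, if_true] at hi ⊢
    obtain ⟨h1, h2⟩ := Finset.mem_filter.1 hi
    have ih := hx.mem_cell π i h1
    refine ⟨(ih a).1, ?_⟩
    split_ifs with ha
    · subst ha; exact le_min (ih _).2 h2
    · exact (ih a).2
  | false :: π, i, hi, a => by
    simp only [stateAt, State.step, Bool.false_eq_true, if_false] at hi ⊢
    obtain ⟨h1, h2⟩ := Finset.mem_filter.1 hi
    have ih := hx.mem_cell π i h1
    refine ⟨?_, (ih a).2⟩
    split_ifs with ha
    · subst ha; exact max_lt (ih _).1 (not_le.1 h2)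
    · exact (ih a).1

open Classical in
-- A non-interior point lies on an upper face, and each of the d upper faces holds at most one point
-- since coordinates are distinct.
theorem card_le_card_interiorPts (hx : InGeneralPosition x) (π : List Bool) :
    (stateAt x π).S.card ≤ (interiorPts x π).card + d := by
  have h1 : ∀ i ∈ (stateAt x π).S \ interiorPts x π, ∃ a, x i a = (stateAt x π).hi a := by
    intro i hi
    obtain ⟨h1, h2⟩ := Finset.mem_sdiff.1 hi
    by_contra! hne
    refine h2 (Finset.mem_filter.2 ⟨h1, State.mem_box.2 fun a => ?_⟩)
    have := hx.mem_cell π i h1 a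
    exact ⟨this.1, lt_of_le_of_ne this.2 (hne a)⟩
  have h2 : ((stateAt x π).S \ interiorPts x π).card ≤ d := by
    choose! f hf using h1
    have := Finset.card_le_card_of_injOn (t := (Finset.univ : Finset (Fin d))) f
      (fun i _ => Finset.mem_univ _) (fun i hi j hj hij => hx.injective (f i)
        ((hf i hi).trans (hij ▸ (hf j hj).symm)))
    simpa using this
  rw [Finset.card_sdiff_of_subset (interiorPts_subset x π)] at h2
  omega

theorem card_S (hx : InGeneralPosition x) {k n₀ : ℕ} (hn₀ : 0 < n₀)
    (hc : Fintype.card ι = 2 ^ k * n₀) : ∀ (π : List Bool) (j : ℕ), j + π.length = k →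
      (stateAt x π).S.card = 2 ^ j * n₀
  | [], j, h => by
    have : j = k := by simpa using h
    rw [this]; simpa [stateAt] using hc
  | b :: π, j, h => by
    have ih := hx.card_S hn₀ hc π (j + 1) (by rw [List.length_cons] at h; omega)
    have ih' : (stateAt x π).S.card = 2 * (2 ^ j * n₀) := by rw [ih]; ring
    have hl := card_filter_le_median_of_injOn (f := fun i => x i (Fin.ofNat d π.length))
      (hx.injective _).injOn (by positivity) ih'
    generalize 2 ^ j * n₀ = h' at ih' hl ⊢
    cases b
    · have := Finset.card_filter_add_card_filter_not (s := (stateAt x π).S)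
        (fun i => x i (Fin.ofNat d π.length) ≤ (stateAt x π).split x π.length)
      simp only [stateAt, State.step, Bool.false_eq_true, if_false]
      rw [State.split] at this ⊢
      rw [hl, ih'] at this
      omega
    · simp only [stateAt, State.step, if_true]
      exact hl

end InGeneralPosition

/-- The tolerance for the split of a node of height `j`. -/
noncomputable def tol (j : ℕ) : ℝ := 1 / 12 * (3 / 4) ^ j

theorem tol_pos (j : ℕ) : 0 < tol j := by unfold tol; positivity

theorem tol_le (j : ℕ) : tol j ≤ 1 / 12 := by
  unfold tol
  have : (3 / 4 : ℝ) ^ j ≤ 1 := pow_le_one₀ (by norm_num) (by norm_num)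
  linarith

/-- The product of the relative errors of the splits above level `l`. -/
noncomputable def slack (k l : ℕ) : ℝ := ∏ i ∈ Finset.range l, (1 - 2 * tol (k - i))

theorem slack_pos (k l : ℕ) : 0 < slack k l :=
  Finset.prod_pos fun i _ => by linarith [tol_le (k - i)]

/-- The losses 2·tol(j), j ≥ 1, form a geometric series of sum 1/2. The remainder (3/4)^(k-l)/2 is
what makes the induction close. -/
theorem slack_ge (k : ℕ) : ∀ l ≤ k, 1 - 1 / 2 * (3 / 4 : ℝ) ^ (k - l) ≤ slack k l
  | 0, _ => by
    simp only [slack, Finset.range_zero, Finset.prod_empty]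
    linarith [show (0 : ℝ) ≤ (3 / 4) ^ (k - 0) by positivity]
  | l + 1, h => by
    have ih := slack_ge k l (by omega)
    obtain ⟨j, hj⟩ : ∃ j, k - l = j + 1 := ⟨k - l - 1, by omega⟩
    have hj' : k - (l + 1) = j := by omega
    rw [slack, Finset.prod_range_succ, ← slack, hj']
    have h1 := tol_le (k - l)
    have hr : (0 : ℝ) ≤ (3 / 4) ^ j := by positivity
    have hr1 : (3 / 4 : ℝ) ^ j ≤ 1 := pow_le_one₀ (by norm_num) (by norm_num)
    rw [hj] at ih h1 ⊢
    refine le_trans ?_ (mul_le_mul_of_nonneg_right ih (by linarith))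
    unfold tol
    rw [pow_succ]
    nlinarith

theorem half_le_slack {k l : ℕ} (h : l ≤ k) : 1 / 2 ≤ slack k l := by
  have := slack_ge k l h
  have : (3 / 4 : ℝ) ^ (k - l) ≤ 1 := pow_le_one₀ (by norm_num) (by norm_num)
  linarith

/-- The splits of all internal nodes are close to the centres of their cells. -/
def Balanced (x : ι → Fin d → ℝ) (k n₀ : ℕ) : Prop :=
  ∀ (π : List Bool), π.length < k →
    ¬ Unbalanced x π (2 ^ (k - π.length - 1) * n₀) d (tol (k - π.length))

variable {x : ι → Fin d → ℝ} {k n₀ : ℕ}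

theorem Balanced.split_mem (hb : Balanced x k n₀) (hx : InGeneralPosition x) (hn₀ : 0 < n₀)
    (hc : Fintype.card ι = 2 ^ k * n₀) {π : List Bool} (hπ : π.length < k)
    (hlt : (stateAt x π).lo (Fin.ofNat d π.length) < (stateAt x π).hi (Fin.ofNat d π.length)) :
    (stateAt x π).lo (Fin.ofNat d π.length) + (1 / 2 - tol (k - π.length)) *
      ((stateAt x π).hi (Fin.ofNat d π.length) - (stateAt x π).lo (Fin.ofNat d π.length)) ≤
      (stateAt x π).split x π.length ∧
    (stateAt x π).split x π.length ≤
      (stateAt x π).hi (Fin.ofNat d π.length) - (1 / 2 - tol (k - π.length)) *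
      ((stateAt x π).hi (Fin.ofNat d π.length) - (stateAt x π).lo (Fin.ofNat d π.length)) := by
  have h := hb π hπ
  have hcard : (stateAt x π).S.card = 2 * (2 ^ (k - π.length - 1) * n₀) := by
    rw [hx.card_S hn₀ hc π (k - π.length) (by omega), ← mul_assoc, ← pow_succ']
    congr 2; omega
  by_contra hcon
  refine h ⟨hcard, hx.card_le_card_interiorPts π, hlt, ?_⟩
  by_contra! h2
  exact hcon h2

/-- The number of splits along coordinate `a` above level `l`. -/
def splitCount (d : ℕ) [NeZero d] (l : ℕ) (a : Fin d) : ℕ :=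
  ((Finset.range l).filter fun i => Fin.ofNat d i = a).card

theorem div_le_splitCount (k : ℕ) (a : Fin d) : k / d ≤ splitCount d k a := by
  have hd : 0 < d := Nat.pos_of_ne_zero (NeZero.ne d)
  have := Finset.card_le_card_of_injOn (s := Finset.range (k / d))
    (t := (Finset.range k).filter fun i => Fin.ofNat d i = a) (fun m => a + d * m) ?_ ?_
  · simpa [splitCount] using this
  · intro m hm
    have hm : m + 1 ≤ k / d := Finset.mem_range.1 hm
    have h1 : d * (m + 1) ≤ k := (Nat.mul_le_mul_left d hm).trans (Nat.mul_div_le k d)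
    refine Finset.mem_coe.2 (Finset.mem_filter.2 ⟨Finset.mem_range.2 ?_, ?_⟩)
    · have := a.2
      rw [Nat.mul_add] at h1
      change (a : ℕ) + d * m < k
      omega
    · ext
      simp [Fin.ofNat, Nat.mod_eq_of_lt a.2]
  · intro m _ m' _ h
    have h : (a : ℕ) + d * m = a + d * m' := h
    exact Nat.eq_of_mul_eq_mul_left hd (by omega)

theorem splitCount_succ (l : ℕ) (a : Fin d) :
    splitCount d (l + 1) a = splitCount d l a + if a = Fin.ofNat d l then 1 else 0 := by
  unfold splitCount
  rw [Finset.range_add_one, Finset.filter_insert]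
  split_ifs with h1 h2 h2
  · simp
  · exact absurd h1.symm h2
  · exact absurd h2.symm h1
  · simp

/-- Side lengths and volumes of the cells of a balanced tree. -/
theorem Balanced.cell_bounds (hb : Balanced x k n₀) (hx : InGeneralPosition x) (hn₀ : 0 < n₀)
    (hc : Fintype.card ι = 2 ^ k * n₀) : ∀ π : List Bool, π.length ≤ k →
      (∀ a, (stateAt x π).lo a < (stateAt x π).hi a) ∧
      (∀ a, ((stateAt x π).hi a - (stateAt x π).lo a) * slack k π.length ≤
        (1 / 2) ^ splitCount d π.length a) ∧
      (1 / 2) ^ π.length * slack k π.length ≤ ∏ a, ((stateAt x π).hi a - (stateAt x π).lo a)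
  | [], _ => by simp [stateAt, slack, splitCount]
  | b :: π, hπ => by
    rw [List.length_cons] at hπ
    obtain ⟨hlt, hside, hvol⟩ := hb.cell_bounds hx hn₀ hc π (by omega)
    have hsp := hb.split_mem hx hn₀ hc (π := π) (by omega) (hlt _)
    have hε := tol_le (k - π.length)
    have hε0 := tol_pos (k - π.length)
    set ε := tol (k - π.length) with hεdef
    set a₀ : Fin d := Fin.ofNat d π.length with ha₀
    set σ := stateAt x π with hσ
    set w := σ.hi a₀ - σ.lo a₀ with hw
    have hw0 : 0 < w := sub_pos.2 (hlt _)
    have hsl := slack_pos k π.length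
    -- `c` is the child's side along the split coordinate; the other sides are unchanged.
    obtain ⟨c, hc1, hc2, hupd⟩ : ∃ c, (1 / 2 - ε) * w ≤ c ∧ c ≤ (1 / 2 + ε) * w ∧
        ∀ a, (σ.step x π.length b).hi a - (σ.step x π.length b).lo a =
          if a = a₀ then c else σ.hi a - σ.lo a := by
      have hεw : 0 < (1 / 2 - ε) * w := mul_pos (by linarith) hw0
      cases b
      · refine ⟨σ.hi a₀ - σ.split x π.length, by linarith, by nlinarith, fun a => ?_⟩
        simp only [State.step, Bool.false_eq_true, if_false, ← ha₀]
        split_ifs with h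
        · rw [h, max_eq_right (by linarith)]
        · rfl
      · refine ⟨σ.split x π.length - σ.lo a₀, by linarith, by nlinarith, fun a => ?_⟩
        simp only [State.step, if_true, ← ha₀]
        split_ifs with h
        · rw [h, min_eq_right (by linarith)]
        · rfl
    have hc0 : 0 < c := lt_of_lt_of_le (mul_pos (by linarith) hw0) hc1
    have hslack : slack k (π.length + 1) = slack k π.length * (1 - 2 * ε) := by
      rw [slack, Finset.prod_range_succ, ← slack]
    simp only [stateAt, List.length_cons]
    refine ⟨fun a => ?_, fun a => ?_, ?_⟩
    · rw [← sub_pos, hupd]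
      split_ifs
      · exact hc0
      · exact sub_pos.2 (hlt a)
    · rw [hupd, hslack, splitCount_succ, ← ha₀]
      split_ifs with h
      · subst h
        -- Since (1 + 2ε)(1 - 2ε) ≤ 1, the factor that bounds volumes from below also bounds sides
        -- from above.
        have h1 : (1 / 2 + ε) * (1 - 2 * ε) ≤ 1 / 2 := by nlinarith
        calc c * (slack k π.length * (1 - 2 * ε))
            ≤ ((1 / 2 + ε) * w) * (slack k π.length * (1 - 2 * ε)) := by
              refine mul_le_mul_of_nonneg_right hc2 (mul_nonneg hsl.le (by linarith))
          _ = (w * slack k π.length) * ((1 / 2 + ε) * (1 - 2 * ε)) := by ring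
          _ ≤ (w * slack k π.length) * (1 / 2) :=
              mul_le_mul_of_nonneg_left h1 (mul_nonneg hw0.le hsl.le)
          _ ≤ _ := by
              rw [pow_succ]
              exact mul_le_mul_of_nonneg_right (hside _) (by norm_num)
      · rw [add_zero]
        refine le_trans ?_ (hside a)
        refine mul_le_mul_of_nonneg_left ?_ (sub_pos.2 (hlt a)).le
        nlinarith
    · rw [Finset.prod_congr rfl fun a _ => hupd a]
      have h1 : ∏ a, (if a = a₀ then c else σ.hi a - σ.lo a) =
          c * ∏ a ∈ Finset.univ.erase a₀, (σ.hi a - σ.lo a) := by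
        rw [← Finset.mul_prod_erase _ _ (Finset.mem_univ a₀), if_pos rfl]
        congr 1
        exact Finset.prod_congr rfl fun a ha => if_neg (Finset.ne_of_mem_erase ha)
      have h2 : ∏ a, (σ.hi a - σ.lo a) = w * ∏ a ∈ Finset.univ.erase a₀, (σ.hi a - σ.lo a) :=
        (Finset.mul_prod_erase _ _ (Finset.mem_univ a₀)).symm
      have h3 : 0 ≤ ∏ a ∈ Finset.univ.erase a₀, (σ.hi a - σ.lo a) :=
        Finset.prod_nonneg fun a _ => (sub_pos.2 (hlt a)).le
      rw [h1, hslack, pow_succ]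
      calc (1 / 2) ^ π.length * (1 / 2) * (slack k π.length * (1 - 2 * ε))
          = ((1 / 2) ^ π.length * slack k π.length) * (1 / 2 - ε) := by ring
        _ ≤ (∏ a, (σ.hi a - σ.lo a)) * (1 / 2 - ε) :=
            mul_le_mul_of_nonneg_right hvol (by linarith)
        _ = ((1 / 2 - ε) * w) * ∏ a ∈ Finset.univ.erase a₀, (σ.hi a - σ.lo a) := by
            rw [h2]; ring
        _ ≤ _ := mul_le_mul_of_nonneg_right hc1 h3

/-- The subtree of height `j` at the end of a path. -/
noncomputable def treeAt (x : ι → Fin d → ℝ) : ℕ → List Bool → Tree d ι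
  | 0, π => .leaf (stateAt x π).S
  | j + 1, π => .node (Fin.ofNat d π.length) ((stateAt x π).split x π.length)
      (treeAt x j (true :: π)) (treeAt x j (false :: π))

theorem builds_treeAt {p : ι → EuclideanSpace ℝ (Fin d)} (hp : ∀ i a, p i a = x i a)
    (hx : InGeneralPosition x) (hn₀ : 0 < n₀) (hc : Fintype.card ι = 2 ^ k * n₀) :
    ∀ (j : ℕ) (π : List Bool), j + π.length = k →
      Builds p n₀ π.length (stateAt x π).S (treeAt x j π)
  | 0, π, h => by
    refine Builds.leaf _ _ ?_
    rw [hx.card_S hn₀ hc π 0 h]; omega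
  | j + 1, π, h => by
    have hs : (stateAt x π).split x π.length =
        median (stateAt x π).S (fun i => p i (Fin.ofNat d π.length)) := by
      simp only [hp]; rfl
    have ht := builds_treeAt hp hx hn₀ hc j (true :: π) (by rw [List.length_cons]; omega)
    have hf := builds_treeAt hp hx hn₀ hc j (false :: π) (by rw [List.length_cons]; omega)
    refine Builds.node _ _ _ _ _ _ ?_ rfl hs ?_ ?_
    · rw [hx.card_S hn₀ hc π (j + 1) h, pow_succ]
      have : 1 ≤ 2 ^ j := Nat.one_le_two_pow
      nlinarith
    · simpa only [hp, stateAt, State.step, if_true, List.length_cons] using ht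
    · simpa only [hp, stateAt, State.step, Bool.false_eq_true, if_false, List.length_cons] using hf

end KdTree

/-! ### Comprehensive search: volume counting of visited cells -/

namespace KdTree

theorem exists_argmin_eq {d : ℕ} {ι : Type*} (p : ι → EuclideanSpace ℝ (Fin d))
    (q : EuclideanSpace ℝ (Fin d)) {A : Finset ι} (hA : A.Nonempty) :
    ∃ i ∈ A, argmin p q A = some i ∧ ∀ j ∈ A, dist q (p i) ≤ dist q (p j) := by
  have h := (A.exists_min_image (fun i => dist (p i) q) hA).choose_spec
  refine ⟨_, h.1, by rw [argmin, dif_pos hA], fun j hj => ?_⟩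
  rw [dist_comm q, dist_comm q]
  exact h.2 j hj

section Clamp

variable {d : ℕ} {lo hi : Fin d → ℝ}

/-- The point of the box with corners `lo`, `hi` closest to `q`. -/
noncomputable def clamp (lo hi : Fin d → ℝ) (q : EuclideanSpace ℝ (Fin d)) :
    EuclideanSpace ℝ (Fin d) :=
  WithLp.toLp 2 fun a => max (lo a) (min (hi a) (q a))

theorem clamp_apply (q : EuclideanSpace ℝ (Fin d)) (a : Fin d) :
    clamp lo hi q a = max (lo a) (min (hi a) (q a)) := rfl

theorem dist_clamp_le {q y : EuclideanSpace ℝ (Fin d)} (hy : ∀ a, lo a ≤ y a ∧ y a ≤ hi a) :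
    dist q (clamp lo hi q) ≤ dist q y := by
  rw [EuclideanSpace.dist_eq, EuclideanSpace.dist_eq]
  refine Real.sqrt_le_sqrt (Finset.sum_le_sum fun a _ => pow_le_pow_left₀ dist_nonneg ?_ 2)
  obtain ⟨h1, h2⟩ := hy a
  rw [clamp_apply, Real.dist_eq, Real.dist_eq]
  rcases le_total (q a) (hi a) with h | h
  · rw [min_eq_right h]
    rcases le_total (lo a) (q a) with h' | h'
    · rw [max_eq_right h', sub_self, abs_zero]; exact abs_nonneg _
    · rw [max_eq_left h', abs_sub_comm, abs_sub_comm (q a), abs_of_nonneg (by linarith),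
        abs_of_nonneg (by linarith)]
      linarith
  · rw [min_eq_left h, max_eq_right (h1.trans h2), abs_of_nonneg (by linarith),
      abs_of_nonneg (by linarith)]
    linarith

theorem dist_le_of_mem_cell {D : ℝ} (hD : 0 ≤ D) (h : ∑ a, (hi a - lo a) ^ 2 ≤ D ^ 2)
    {y z : EuclideanSpace ℝ (Fin d)} (hy : ∀ a, lo a ≤ y a ∧ y a ≤ hi a)
    (hz : ∀ a, lo a ≤ z a ∧ z a ≤ hi a) : dist y z ≤ D := by
  rw [EuclideanSpace.dist_eq]
  refine Real.sqrt_le_iff.2 ⟨hD, le_trans (Finset.sum_le_sum fun a _ =>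
    pow_le_pow_left₀ dist_nonneg ?_ 2) h⟩
  rw [Real.dist_eq, abs_le]
  constructor <;> linarith [(hy a).1, (hy a).2, (hz a).1, (hz a).2]

end Clamp

variable {d : ℕ} [NeZero d] {ι : Type*} [Fintype ι]

/-- The trivial count of all leaves, sufficient when the tree has at most d levels of splits. -/
theorem length_search_le (x : ι → Fin d → ℝ) (p : ι → EuclideanSpace ℝ (Fin d))
    (q : EuclideanSpace ℝ (Fin d)) : ∀ (j : ℕ) (π : List Bool) (C : Set _) (best : Option ι),
    (search p q (treeAt x j π) C best).2.length ≤ 2 ^ j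
  | 0, _, _, _ => by simp [treeAt, search]
  | j + 1, π, C, best => by
    simp only [treeAt, search]
    have h : ∀ b C best, (search p q (treeAt x j (b :: π)) C best).2.length ≤ 2 ^ j :=
      fun b => length_search_le x p q j (b :: π)
    have h2 : 2 ^ (j + 1) = 2 ^ j + 2 ^ j := by ring
    split_ifs <;> simp only [List.length_append, h2] <;>
      first
      | exact Nat.add_le_add (h _ _ _) (h _ _ _)
      | exact (h _ _ _).trans (Nat.le_add_right _ _)

/-- `C` lies between the open and the closed box of the state `σ`. -/
def State.IsCell (σ : State d ι) (C : Set (EuclideanSpace ℝ (Fin d))) : Prop :=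
  (∀ y : EuclideanSpace ℝ (Fin d), (∀ a, σ.lo a < y a ∧ y a < σ.hi a) → y ∈ C) ∧
    ∀ y ∈ C, ∀ a, σ.lo a ≤ y a ∧ y a ≤ σ.hi a

/-- Which faces belong to a cell depends on the path. The sandwich suffices: volumes use only the
open box, distances only the closed one. -/
theorem State.IsCell.step_true {σ : State d ι} {C : Set (EuclideanSpace ℝ (Fin d))}
    (h : σ.IsCell C) (x : ι → Fin d → ℝ) (l : ℕ) :
    (σ.step x l true).IsCell (C ∩ {y | y (Fin.ofNat d l) ≤ σ.split x l}) := by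
  simp only [IsCell, step, if_true]
  refine ⟨fun y hy => ⟨h.1 y fun a => ⟨(hy a).1, ?_⟩, ?_⟩, fun y hy a => ⟨(h.2 y hy.1 a).1, ?_⟩⟩
  · have := (hy a).2
    split_ifs at this
    · exact this.trans_le (min_le_left _ _)
    · exact this
  · have := (hy (Fin.ofNat d l)).2
    rw [if_pos rfl] at this
    exact (this.trans_le (min_le_right _ _)).le
  · split_ifs with ha
    · subst ha; exact le_min (h.2 y hy.1 _).2 hy.2
    · exact (h.2 y hy.1 a).2

theorem State.IsCell.step_false {σ : State d ι} {C : Set (EuclideanSpace ℝ (Fin d))}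
    (h : σ.IsCell C) (x : ι → Fin d → ℝ) (l : ℕ) :
    (σ.step x l false).IsCell (C ∩ {y | ¬ y (Fin.ofNat d l) ≤ σ.split x l}) := by
  simp only [IsCell, step, Bool.false_eq_true, if_false]
  refine ⟨fun y hy => ⟨h.1 y fun a => ⟨?_, (hy a).2⟩, ?_⟩, fun y hy a => ⟨?_, (h.2 y hy.1 a).2⟩⟩
  · have := (hy a).1
    split_ifs at this
    · exact (le_max_left _ _).trans_lt this
    · exact this
  · have := (hy (Fin.ofNat d l)).1
    rw [if_pos rfl] at this
    exact not_le.2 ((le_max_right _ _).trans_lt this)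
  · split_ifs with ha
    · subst ha; exact max_le (h.2 y hy.1 _).1 (not_le.1 hy.2).le
    · exact (h.2 y hy.1 a).1

/-- Descending to the side of q leaves the nearest point of the closed box unchanged, so the
distance invariant passes to the first child; for the second it comes from the backtracking test. -/
theorem clamp_step_true {σ : State d ι} {x : ι → Fin d → ℝ} {l : ℕ}
    {q : EuclideanSpace ℝ (Fin d)} (hq : q (Fin.ofNat d l) ≤ σ.split x l)
    (hs : σ.split x l ≤ σ.hi (Fin.ofNat d l)) :
    clamp (σ.step x l true).lo (σ.step x l true).hi q = clamp σ.lo σ.hi q := by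
  ext a
  simp only [clamp_apply, State.step, if_true]
  split_ifs with ha
  · subst ha
    rw [min_eq_right hs, min_eq_right hq, min_eq_right (hq.trans hs)]
  · rfl

theorem clamp_step_false {σ : State d ι} {x : ι → Fin d → ℝ} {l : ℕ}
    {q : EuclideanSpace ℝ (Fin d)} (hq : ¬ q (Fin.ofNat d l) ≤ σ.split x l)
    (hs : σ.lo (Fin.ofNat d l) ≤ σ.split x l) (hs' : σ.split x l ≤ σ.hi (Fin.ofNat d l)) :
    clamp (σ.step x l false).lo (σ.step x l false).hi q = clamp σ.lo σ.hi q := by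
  ext a
  simp only [clamp_apply, State.step, Bool.false_eq_true, if_false]
  split_ifs with ha
  · subst ha
    have : σ.split x l ≤ min (σ.hi (Fin.ofNat d l)) (q (Fin.ofNat d l)) := le_min hs' (not_le.1 hq).le
    rw [max_eq_right hs, max_eq_right this, max_eq_right (hs.trans this)]
  · rfl

theorem dist_clamp_le_of_meets {p : ι → EuclideanSpace ℝ (Fin d)}
    {q : EuclideanSpace ℝ (Fin d)} {σ : State d ι} {C : Set (EuclideanSpace ℝ (Fin d))}
    (hC : σ.IsCell C) {best : Option ι} {D : ℝ}
    (hbest : ∃ i, best = some i ∧ dist q (p i) ≤ D) (h : Meets p q C best) :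
    dist q (clamp σ.lo σ.hi q) ≤ D := by
  obtain ⟨i, rfl, hi⟩ := hbest
  obtain ⟨y, hyC, hy⟩ := h
  refine (dist_clamp_le (hC.2 y hyC)).trans ?_
  rw [dist_comm]
  exact (Metric.mem_ball.1 hy).le.trans hi

/-- The visited leaf cells fit into a ball of twice the radius of a leaf cell. -/
theorem length_search_mul_le {x : ι → Fin d → ℝ} {p : ι → EuclideanSpace ℝ (Fin d)}
    (hp : ∀ i a, p i a = x i a) (q : EuclideanSpace ℝ (Fin d)) {k : ℕ} {D : ℝ} (hD : 0 ≤ D)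
    {v : ENNReal}
    (hmem : ∀ π, π.length = k → ∀ i ∈ (stateAt x π).S, ∀ a,
      (stateAt x π).lo a ≤ x i a ∧ x i a ≤ (stateAt x π).hi a)
    (hne : ∀ π, π.length = k → (stateAt x π).S.Nonempty)
    (hle : ∀ π, π.length = k → ∀ a, (stateAt x π).lo a ≤ (stateAt x π).hi a)
    (hdiam : ∀ π, π.length = k →
      ∑ a, ((stateAt x π).hi a - (stateAt x π).lo a) ^ 2 ≤ D ^ 2)
    (hvol : ∀ π, π.length = k → v ≤ volume (stateAt x π).box)
    (hsplit : ∀ π, π.length < k →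
      (stateAt x π).lo (Fin.ofNat d π.length) ≤ (stateAt x π).split x π.length ∧
      (stateAt x π).split x π.length ≤ (stateAt x π).hi (Fin.ofNat d π.length)) :
    ∀ (j : ℕ) (π : List Bool) (C : Set (EuclideanSpace ℝ (Fin d))) (best : Option ι),
      j + π.length = k → (stateAt x π).IsCell C →
      ((∃ i, best = some i ∧ dist q (p i) ≤ D) ∨ (best = none ∧ q ∈ C)) →
      dist q (clamp (stateAt x π).lo (stateAt x π).hi q) ≤ D →
      (∃ i, (search p q (treeAt x j π) C best).1 = some i ∧ dist q (p i) ≤ D) ∧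
      ((search p q (treeAt x j π) C best).2.length : ENNReal) * v ≤
        volume (C ∩ Metric.closedBall q (2 * D))
  | 0, π, C, best, hk, hC, hbest, hclamp => by
    classical
    rw [zero_add] at hk
    simp only [treeAt, search, List.length_singleton, Nat.cast_one, one_mul]
    refine ⟨?_, ?_⟩
    · have : ∃ i ∈ (stateAt x π).S ∪ best.toFinset, dist q (p i) ≤ D := by
        rcases hbest with ⟨i, rfl, hi⟩ | ⟨rfl, hqC⟩
        · exact ⟨i, by simp, hi⟩
        · obtain ⟨i, hi⟩ := hne π hk
          refine ⟨i, Finset.mem_union_left _ hi, dist_le_of_mem_cell hD (hdiam π hk) (hC.2 q hqC) ?_⟩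
          intro a
          rw [hp]
          exact hmem π hk i hi a
      obtain ⟨i, hi, hiD⟩ := this
      obtain ⟨i', -, h1, h2⟩ := exists_argmin_eq p q ⟨i, hi⟩
      refine ⟨i', ?_, (h2 i hi).trans hiD⟩
      convert h1
    -- One D reaches the nearest point of the cell, a second D crosses the cell.
    · have hCB : C ∩ Metric.closedBall q (2 * D) = C := by
        refine Set.inter_eq_left.2 fun y hy => Metric.mem_closedBall.2 ?_
        have h1 : dist (clamp (stateAt x π).lo (stateAt x π).hi q) y ≤ D := by
          refine dist_le_of_mem_cell hD (hdiam π hk) (fun a => ?_) (hC.2 y hy)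
          rw [clamp_apply]
          exact ⟨le_max_left _ _, max_le (hle π hk a) (min_le_left _ _)⟩
        rw [dist_comm]
        linarith [dist_triangle q (clamp (stateAt x π).lo (stateAt x π).hi q) y]
      rw [hCB]
      refine (hvol π hk).trans ?_
      rw [← (EuclideanSpace.volume_preserving_symm_measurableEquiv_toLp (Fin d)).measure_preimage_equiv]
      exact measure_mono fun y hy => hC.1 y (State.mem_box.1 hy)
  | j + 1, π, C, best, hk, hC, hbest, hclamp => by
    have ih := fun b => length_search_mul_le hp q hD hmem hne hle hdiam hvol hsplit j (b :: π)
    have hk' : ∀ b : Bool, j + (b :: π).length = k := fun b => by rw [List.length_cons]; omega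
    obtain ⟨hs1, hs2⟩ := hsplit π (by omega)
    have hCt := hC.step_true x π.length
    have hCf := hC.step_false x π.length
    set a := Fin.ofNat d π.length with ha
    set s := (stateAt x π).split x π.length with hs
    have hmeas : MeasurableSet {y : EuclideanSpace ℝ (Fin d) | y a ≤ s} :=
      measurableSet_le (by fun_prop) measurable_const
    -- The children partition the cell, so the counts of disjoint visited leaves add up with their
    -- volumes.
    have hsum : volume (C ∩ {y | y a ≤ s} ∩ Metric.closedBall q (2 * D)) +
        volume (C ∩ {y | ¬ y a ≤ s} ∩ Metric.closedBall q (2 * D)) =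
        volume (C ∩ Metric.closedBall q (2 * D)) := by
      rw [← measure_inter_add_sdiff (C ∩ Metric.closedBall q (2 * D)) hmeas, Set.inter_right_comm,
        Set.inter_right_comm C {y | ¬ y a ≤ s}]
      rfl
    simp only [treeAt, search]
    by_cases hq : q a ≤ s
    · rw [if_pos hq]
      have h1 := ih true _ best (hk' true) hCt
        (hbest.imp_right fun h => ⟨h.1, h.2, hq⟩)
        (by simp only [stateAt]; rwa [clamp_step_true hq hs2])
      split_ifs with hm
      · have h2 := ih false _ _ (hk' false) hCf (Or.inl h1.1) (dist_clamp_le_of_meets hCf h1.1 hm)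
        refine ⟨h2.1, ?_⟩
        rw [List.length_append, Nat.cast_add, add_mul, ← hsum]
        exact add_le_add h1.2 h2.2
      · exact ⟨h1.1, h1.2.trans (hsum ▸ le_self_add)⟩
    · rw [if_neg hq]
      have h1 := ih false _ best (hk' false) hCf
        (hbest.imp_right fun h => ⟨h.1, h.2, hq⟩)
        (by simp only [stateAt]; rwa [clamp_step_false hq hs1 hs2])
      split_ifs with hm
      · have h2 := ih true _ _ (hk' true) hCt (Or.inl h1.1) (dist_clamp_le_of_meets hCt h1.1 hm)
        refine ⟨h2.1, ?_⟩
        rw [List.length_append, Nat.cast_add, add_mul, ← hsum, add_comm]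
        exact add_le_add h2.2 h1.2
      · exact ⟨h1.1, h1.2.trans (hsum ▸ le_add_self)⟩

end KdTree

/-! ### Volume of a Euclidean ball -/

namespace KdTree

/-- Markov's inequality for the Gaussian exp(-b‖v‖²) bounds the volume by exp(bR²)(π/b)^(d/2); b =
d/(2R²) minimises this. -/
theorem volume_closedBall_le (d : ℕ) (q : EuclideanSpace ℝ (Fin d)) (hd : 0 < d) {R : ℝ}
    (hR : 0 < R) : volume (Metric.closedBall q R) ≤
      ENNReal.ofReal ((R * √(2 * Real.pi * Real.exp 1 / d)) ^ d) := by
  have hd' : (0 : ℝ) < d := by exact_mod_cast hd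
  set b : ℝ := d / (2 * R ^ 2) with hb
  have hb0 : 0 < b := by positivity
  rw [Measure.addHaar_closedBall_center]
  have hint := GaussianFourier.integral_rexp_neg_mul_sq_norm (V := EuclideanSpace ℝ (Fin d)) hb0
  -- A non-integrable function would have integral 0 by convention, but the Gaussian formula gives a
  -- positive value.
  have hintg : Integrable (fun v : EuclideanSpace ℝ (Fin d) => Real.exp (-b * ‖v‖ ^ 2)) := by
    by_contra h
    rw [integral_undef h] at hint
    have : 0 < (Real.pi / b) ^ ((Module.finrank ℝ (EuclideanSpace ℝ (Fin d)) : ℝ) / 2) := by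
      positivity
    linarith
  have hmk := mul_meas_ge_le_integral_of_nonneg (Filter.Eventually.of_forall fun v : EuclideanSpace ℝ (Fin d) =>
    (Real.exp_nonneg (-b * ‖v‖ ^ 2))) hintg (Real.exp (-b * R ^ 2))
  rw [hint, finrank_euclideanSpace_fin, Real.rpow_div_two_eq_sqrt _ (by positivity),
    Real.rpow_natCast] at hmk
  have hsub : Metric.closedBall (0 : EuclideanSpace ℝ (Fin d)) R ⊆
      {v | Real.exp (-b * R ^ 2) ≤ Real.exp (-b * ‖v‖ ^ 2)} := by
    intro v hv
    have hv : ‖v‖ ≤ R := by simpa using hv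
    refine Real.exp_le_exp.2 ?_
    have : ‖v‖ ^ 2 ≤ R ^ 2 := pow_le_pow_left₀ (norm_nonneg _) hv 2
    nlinarith
  have hfin : volume {v : EuclideanSpace ℝ (Fin d) |
      Real.exp (-b * R ^ 2) ≤ Real.exp (-b * ‖v‖ ^ 2)} ≠ ⊤ :=
    (hintg.measure_ge_lt_top (Real.exp_pos _)).ne
  refine (measure_mono hsub).trans ?_
  rw [← ENNReal.ofReal_toReal hfin]
  refine ENNReal.ofReal_le_ofReal ?_
  rw [measureReal_def] at hmk
  have hbR : b * R ^ 2 = d / 2 := by rw [hb]; field_simp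
  have he : Real.exp (-b * R ^ 2) * √(Real.exp 1) ^ d = 1 := by
    rw [neg_mul, hbR, ← Real.rpow_natCast, ← Real.rpow_div_two_eq_sqrt _ (Real.exp_nonneg _),
      ← Real.exp_mul, ← Real.exp_add]
    simp
  have hπ : √(Real.pi / b) * √(Real.exp 1) = R * √(2 * Real.pi * Real.exp 1 / d) := by
    rw [← Real.sqrt_mul (by positivity)]
    conv_rhs => rw [← Real.sqrt_sq hR.le, ← Real.sqrt_mul (by positivity)]
    congr 1
    rw [hb]; field_simp
  rw [← hπ, mul_pow]
  have h1 := mul_le_mul_of_nonneg_right hmk (show 0 ≤ √(Real.exp 1) ^ d by positivity)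
  rw [mul_right_comm, he, one_mul] at h1
  exact h1

end KdTree

/-! ### Deterministic bound for balanced trees -/

namespace KdTree

section Deterministic

variable {d : ℕ} [NeZero d] {ι : Type*} [Fintype ι]

theorem numVisited_le_of_balanced {x : ι → Fin d → ℝ} {p : ι → EuclideanSpace ℝ (Fin d)}
    (hp : ∀ i a, p i a = x i a) {k n₀ : ℕ} (hb : Balanced x k n₀) (hx : InGeneralPosition x)
    (hn₀ : 0 < n₀) (hc : Fintype.card ι = 2 ^ k * n₀) {q : EuclideanSpace ℝ (Fin d)}
    (hq : q ∈ unitCube d) :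
    (numVisited p q (treeAt x k []) : ℝ) ≤ (8 * √(2 * Real.pi * Real.exp 1)) ^ d := by
  have hd : 0 < d := Nat.pos_of_ne_zero (NeZero.ne d)
  have hd' : (0 : ℝ) < d := by exact_mod_cast hd
  set t := k / d with ht
  -- The factor 2 is the reciprocal of the lower bound 1/2 on the slack.
  set r : ℝ := 2 * (1 / 2) ^ t with hr
  have hr0 : 0 < r := by positivity
  have hbd := hb.cell_bounds hx hn₀ hc
  have hside : ∀ π : List Bool, π.length = k → ∀ a,
      (stateAt x π).hi a - (stateAt x π).lo a ≤ r := by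
    intro π hπ a
    obtain ⟨h1, h2, -⟩ := hbd π hπ.le
    have h3 := h2 a
    rw [hπ] at h3
    have h4 : (1 / 2 : ℝ) ^ splitCount d k a ≤ (1 / 2) ^ t :=
      pow_le_pow_of_le_one (by norm_num) (by norm_num) (div_le_splitCount k a)
    have h5 := half_le_slack (le_refl k)
    have h6 := sub_pos.2 (h1 a)
    nlinarith
  have hmain := length_search_mul_le hp q (k := k) (D := √d * r) (by positivity)
    (v := ENNReal.ofReal ((1 / 2) ^ k * (1 / 2)))
    (fun π _ i hi a => ⟨(hx.mem_cell π i hi a).1.le, (hx.mem_cell π i hi a).2⟩)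
    (fun π hπ => Finset.card_pos.1 (by
      rw [hx.card_S hn₀ hc π 0 (by omega)]; simpa using hn₀))
    (fun π hπ a => ((hbd π hπ.le).1 a).le)
    (fun π hπ => by
      refine (Finset.sum_le_sum fun a _ => pow_le_pow_left₀
        (sub_pos.2 ((hbd π hπ.le).1 a)).le (hside π hπ a) 2).trans (le_of_eq ?_)
      rw [Finset.sum_const, Finset.card_univ, Fintype.card_fin, nsmul_eq_mul, mul_pow √(d : ℝ) r,
        Real.sq_sqrt hd'.le])
    (fun π hπ => by
      rw [State.box, Real.volume_pi_Ioo, ← ENNReal.ofReal_prod_of_nonneg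
        fun a _ => (sub_pos.2 ((hbd π hπ.le).1 a)).le]
      refine ENNReal.ofReal_le_ofReal (le_trans ?_ (hbd π hπ.le).2.2)
      rw [hπ]
      exact mul_le_mul_of_nonneg_left (half_le_slack le_rfl) (by positivity))
    (fun π hπ => by
      have hlt := (hbd π hπ.le).1 (Fin.ofNat d π.length)
      have h := hb.split_mem hx hn₀ hc hπ hlt
      have hε := tol_le (k - π.length)
      have := mul_nonneg (show 0 ≤ 1 / 2 - tol (k - π.length) by linarith) (sub_pos.2 hlt).le
      constructor <;> linarith)
    k [] (unitCube d) none (by simp)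
    ⟨fun y hy a => ⟨(hy a).1.le, (hy a).2.le⟩, fun y hy a => hy a⟩ (Or.inr ⟨rfl, hq⟩)
    (by
      refine (dist_clamp_le (y := q) fun a => hq a).trans ?_
      rw [dist_self]; positivity)
  have h1 := hmain.2.trans ((measure_mono Set.inter_subset_right).trans
    (volume_closedBall_le d q hd (R := 2 * (√d * r)) (by positivity)))
  rw [← ENNReal.ofReal_natCast, ← ENNReal.ofReal_mul (Nat.cast_nonneg _),
    ENNReal.ofReal_le_ofReal_iff (by positivity)] at h1
  change (numVisited p q (treeAt x k []) : ℝ) * _ ≤ _ at h1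
  have h2 : 2 * (√d * r) * √(2 * Real.pi * Real.exp 1 / d) =
      4 * √(2 * Real.pi * Real.exp 1) * (1 / 2) ^ t := by
    rw [Real.sqrt_div' _ hd'.le, hr]
    have : √(d : ℝ) ≠ 0 := (Real.sqrt_pos.2 hd').ne'
    field_simp
    ring
  rw [h2, mul_pow, ← pow_mul] at h1
  -- Rounding k/d down and halving the leaf volume together cost at most 2^d, which turns the 4 from
  -- the radius into 8.
  have hk : k + 1 ≤ t * d + d := by
    have := Nat.lt_div_mul_add (a := k) hd
    rw [← ht] at this
    omega
  have h3 : (1 / 2 : ℝ) ^ (t * d) ≤ 2 ^ d * ((1 / 2) ^ k * (1 / 2)) := by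
    have : (1 / 2 : ℝ) ^ (t * d + d) ≤ (1 / 2) ^ (k + 1) :=
      pow_le_pow_of_le_one (by norm_num) (by norm_num) hk
    rw [pow_succ, pow_add] at this
    have h2d : (2 : ℝ) ^ d * (1 / 2) ^ d = 1 := by rw [← mul_pow]; norm_num
    calc (1 / 2 : ℝ) ^ (t * d) = 2 ^ d * ((1 / 2) ^ (t * d) * (1 / 2) ^ d) := by
          rw [mul_left_comm, h2d, mul_one]
      _ ≤ _ := mul_le_mul_of_nonneg_left this (by positivity)
  have h4 : (8 * √(2 * Real.pi * Real.exp 1)) ^ d =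
      (4 * √(2 * Real.pi * Real.exp 1)) ^ d * 2 ^ d := by
    rw [← mul_pow]; ring
  refine le_of_mul_le_mul_right (h1.trans ?_) (show (0 : ℝ) < (1 / 2) ^ k * (1 / 2) by positivity)
  have h5 := mul_le_mul_of_nonneg_left h3
    (show (0 : ℝ) ≤ (4 * √(2 * Real.pi * Real.exp 1)) ^ d by positivity)
  rw [h4]
  linarith

end Deterministic

/-! ### General position almost surely, union bound, law of the sample -/

section Probability

variable {d : ℕ}

theorem unitLaw_hyperplane (a : Fin d) (c : ℝ) : unitLaw d {y | y a = c} = 0 :=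
  le_antisymm ((Measure.restrict_apply_le _ _).trans
    (Measure.pi_hyperplane (fun _ => (volume : Measure ℝ)) a c).le) zero_le

theorem ae_inGeneralPosition (ι : Type*) [Fintype ι] :
    ∀ᵐ x ∂(Measure.pi fun _ : ι => unitLaw d), InGeneralPosition x := by
  classical
  have h0 : ∀ (i : ι) (a : Fin d) (c : ℝ), ∀ᵐ x ∂(Measure.pi fun _ : ι => unitLaw d),
      x i a ≠ c := fun i a c =>
    (Measure.tendsto_eval_ae_ae (μ := fun _ : ι => unitLaw d) (i := i)).eventually
      (compl_mem_ae_iff.2 (unitLaw_hyperplane a c))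
  have h1 : ∀ i : ι, ∀ᵐ x ∂(Measure.pi fun _ : ι => unitLaw d),
      x i ∈ Set.univ.pi fun _ : Fin d => Set.Icc (0 : ℝ) 1 := fun i =>
    (Measure.tendsto_eval_ae_ae (μ := fun _ : ι => unitLaw d) (i := i)).eventually
      (ae_restrict_mem (MeasurableSet.univ_pi fun _ => measurableSet_Icc))
  have h2 : ∀ (a : Fin d) (i j : ι), i ≠ j → ∀ᵐ x ∂(Measure.pi fun _ : ι => unitLaw d),
      x i a ≠ x j a := by
    intro a i j hij
    have hm : MeasurableSet {x : ι → Fin d → ℝ | x i a = x j a} :=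
      measurableSet_eq_fun (by fun_prop) (by fun_prop)
    -- With every point but the i-th frozen, the coincidence confines that point to a hyperplane, a
    -- null set.
    have := measure_pi_le_of_section_le (unitLaw d) {i} hm MeasurableSet.univ ENNReal.zero_ne_top
      fun x => by
        rw [zero_mul]
        refine le_of_eq ?_
        have hs : {z : ({i} : Finset ι) → Fin d → ℝ |
            (fun i' => if hi : i' ∈ ({i} : Finset ι) then z ⟨i', hi⟩ else x i') ∈
            {x : ι → Fin d → ℝ | x i a = x j a}} =
            Function.eval (⟨i, Finset.mem_singleton_self i⟩ : ({i} : Finset ι)) ⁻¹'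
              {y | y a = x j a} := by
          ext z
          simp [hij.symm]
        exact (congrArg _ hs).trans (Measure.pi_eval_preimage_null _ (unitLaw_hyperplane a (x j a)))
    rw [zero_mul] at this
    exact compl_mem_ae_iff.2 (le_antisymm this zero_le)
  have h2' : ∀ (a : Fin d) (i j : ι), ∀ᵐ x ∂(Measure.pi fun _ : ι => unitLaw d),
      i ≠ j → x i a ≠ x j a := fun a i j =>
    Filter.eventually_imp_distrib_left.2 (h2 a i j)
  filter_upwards [ae_all_iff.2 fun i => ae_all_iff.2 fun a => h0 i a 0,
    ae_all_iff.2 fun i => ae_all_iff.2 fun a => h0 i a 1, ae_all_iff.2 h1,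
    ae_all_iff.2 fun a => ae_all_iff.2 fun i => ae_all_iff.2 fun j => h2' a i j] with x hx0 hx1 hx2 hx3
  refine ⟨fun i a => lt_of_le_of_ne (hx2 i a trivial).1 (hx0 i a).symm,
    fun i a => lt_of_le_of_ne (hx2 i a trivial).2 (hx1 i a), fun a i j hij => ?_⟩
  by_contra hne
  exact hx3 a i j hne hij

theorem unitCube_eq_preimage : unitCube d =
    (WithLp.ofLp : EuclideanSpace ℝ (Fin d) → Fin d → ℝ) ⁻¹'
      (Set.univ.pi fun _ => Set.Icc (0 : ℝ) 1) := by
  ext y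
  simp only [unitCube, Set.mem_preimage, Set.mem_univ_pi]
  rfl

theorem volume_unitCube : volume (unitCube d) = 1 := by
  rw [unitCube_eq_preimage, (PiLp.volume_preserving_ofLp (Fin d)).measure_preimage
    (MeasurableSet.univ_pi fun _ => measurableSet_Icc).nullMeasurableSet, volume_pi_pi]
  simp

variable [NeZero d] {ι : Type*} [Fintype ι]

theorem measurableSet_balanced (k n₀ : ℕ) :
    MeasurableSet {x : ι → Fin d → ℝ | Balanced x k n₀} := by
  simp only [Balanced, Set.ofPred_forall]
  exact MeasurableSet.iInter fun π => MeasurableSet.iInter fun _ =>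
    (measurableSet_unbalanced π _ _ _).compl

/-- At height j + 1 the exponent is n₀/256·(9/8)^j, because doubling the points outweighs the factor
(3/4)² on the squared tolerance; the lowest splits are the worst. -/
theorem measure_not_balanced_le (k n₀ : ℕ) (hn₀ : 0 < n₀) (hd : 24 * d ≤ n₀) :
    Measure.pi (fun _ : ι => unitLaw d) {x | ¬ Balanced x k n₀} ≤
      ENNReal.ofReal (2 ^ k * (2 * Real.exp (-(n₀ / 288)))) := by
  have hβ : ∀ π : List Bool, π.length < k → Measure.pi (fun _ : ι => unitLaw d)
      {x | Unbalanced x π (2 ^ (k - π.length - 1) * n₀) d (tol (k - π.length))} ≤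
      ENNReal.ofReal (2 * Real.exp (-(n₀ / 288))) := by
    intro π hπ
    obtain ⟨j, hj⟩ : ∃ j, k - π.length = j + 1 := ⟨k - π.length - 1, by omega⟩
    rw [hj, Nat.add_sub_cancel]
    have hd' : 24 * (d : ℝ) ≤ n₀ := by exact_mod_cast hd
    have h2j : 1 ≤ 2 ^ j := Nat.one_le_two_pow
    have hn₀' : (0 : ℝ) ≤ n₀ := Nat.cast_nonneg _
    have e1 : ((2 ^ j * n₀ : ℕ) : ℝ) * tol (j + 1) = n₀ / 16 * (3 / 2) ^ j := by
      rw [tol, show (3 / 2 : ℝ) = 2 * (3 / 4) by norm_num, mul_pow]; push_cast; ring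
    have e2 : ((2 ^ j * n₀ : ℕ) : ℝ) * tol (j + 1) ^ 2 = n₀ / 256 * (9 / 8) ^ j := by
      have e3 : (9 / 8 : ℝ) ^ j = 2 ^ j * (3 / 4) ^ j * (3 / 4) ^ j := by
        rw [← mul_pow, ← mul_pow]; norm_num
      rw [tol, e3, pow_succ (3 / 4 : ℝ) j]
      generalize (3 / 4 : ℝ) ^ j = y
      push_cast; ring
    have g1 : (1 : ℝ) ≤ (3 / 2) ^ j := one_le_pow₀ (by norm_num)
    have g2 : (1 : ℝ) ≤ (9 / 8) ^ j := one_le_pow₀ (by norm_num)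
    refine (measure_unbalanced_le π (by positivity) (tol_pos _).le
      ((tol_le _).trans (by norm_num)) ?_ ?_).trans (ENNReal.ofReal_le_ofReal ?_)
    -- The boundary points are absorbed: d ≤ n₀/24 ≤ n₀/16·(3/2)^j.
    · rw [e1]; nlinarith
    · nlinarith
    · refine mul_le_mul_of_nonneg_left (Real.exp_le_exp.2 ?_) (by norm_num)
      rw [e2]; nlinarith
  have hsub : {x : ι → Fin d → ℝ | ¬ Balanced x k n₀} ⊆
      ⋃ l : Fin k, ⋃ π : List.Vector Bool l, {x | Unbalanced x π.1
        (2 ^ (k - π.1.length - 1) * n₀) d (tol (k - π.1.length))} := by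
    intro x hx
    have hx : ¬ Balanced x k n₀ := hx
    simp only [Balanced, not_forall, not_not] at hx
    obtain ⟨π, hπ, h⟩ := hx
    exact Set.mem_iUnion.2 ⟨⟨π.length, hπ⟩, Set.mem_iUnion.2 ⟨⟨π, rfl⟩, h⟩⟩
  refine (measure_mono hsub).trans ((measure_iUnion_fintype_le _ _).trans ?_)
  calc ∑ l : Fin k, Measure.pi (fun _ : ι => unitLaw d) (⋃ π : List.Vector Bool l,
        {x | Unbalanced x π.1 (2 ^ (k - π.1.length - 1) * n₀) d (tol (k - π.1.length))})
      ≤ ∑ l : Fin k, (2 ^ (l : ℕ) : ℕ) * ENNReal.ofReal (2 * Real.exp (-(n₀ / 288))) := by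
        refine Finset.sum_le_sum fun l _ => (measure_iUnion_fintype_le _ _).trans ?_
        refine (Finset.sum_le_sum fun π _ => hβ π.1 (by rw [π.2]; exact l.2)).trans (le_of_eq ?_)
        rw [Finset.sum_const, Finset.card_univ, card_vector, Fintype.card_bool, nsmul_eq_mul]
    _ ≤ _ := by
        rw [← Finset.sum_mul, ← Nat.cast_sum, Fin.sum_univ_eq_sum_range (fun l => 2 ^ l),
          ENNReal.ofReal_mul (p := 2 ^ k) (by positivity), ← ENNReal.ofReal_natCast]
        gcongr
        exact_mod_cast (Nat.geomSum_lt (m := 2) (n := k) (s := Finset.range k) le_rfl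
          fun i hi => Finset.mem_range.1 hi).le

theorem map_eq_pi_unitLaw {Ω : Type*} [MeasurableSpace Ω] (P : Measure Ω)
    [IsProbabilityMeasure P] {X : ι → Ω → EuclideanSpace ℝ (Fin d)} (hX : ∀ i, Measurable (X i))
    (hind : iIndepFun X P) (hunif : ∀ i, pdf.IsUniform (X i) (unitCube d) P volume) :
    P.map (fun ω i a => X i ω a) = Measure.pi fun _ : ι => unitLaw d := by
  have hmeas : Measurable (WithLp.ofLp : EuclideanSpace ℝ (Fin d) → Fin d → ℝ) :=
    (PiLp.volume_preserving_ofLp (Fin d)).measurable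
  have hind' := hind.comp (fun _ => (WithLp.ofLp : EuclideanSpace ℝ (Fin d) → Fin d → ℝ))
    fun _ => hmeas
  have h1 := (iIndepFun_iff_map_fun_eq_pi_map fun i => (hmeas.comp (hX i)).aemeasurable).1 hind'
  refine h1.trans ?_
  congr 1
  funext i
  rw [← Measure.map_map hmeas (hX i), hunif i, ProbabilityTheory.cond, volume_unitCube, inv_one,
    one_smul, unitCube_eq_preimage]
  exact ((PiLp.volume_preserving_ofLp (Fin d)).restrict_preimage
    (MeasurableSet.univ_pi fun _ => measurableSet_Icc)).map_eq

end Probability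

theorem two_lt_exp_one : (2 : ℝ) < Real.exp 1 := by linarith [Real.exp_one_gt_d9]

/-- If the failure bound is below one, the tree has few levels. -/
theorem mul_levels_le {k n₀ : ℕ} (hn₀ : 0 < n₀)
    (h : (2 : ℝ) ^ k * n₀ * Real.exp (-(n₀ / 288)) < 1) : 24 * k ≤ n₀ := by
  have hn : (1 : ℝ) ≤ n₀ := by exact_mod_cast hn₀
  have h1 : (2 : ℝ) ^ k * Real.exp (-(n₀ / 288)) < 1 := by
    refine lt_of_le_of_lt ?_ h
    refine mul_le_mul_of_nonneg_right ?_ (Real.exp_nonneg _)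
    nlinarith [show (0 : ℝ) < 2 ^ k by positivity]
  -- Replacing 2 by √e gives k/2 < n₀/288, more than enough.
  have h2 : Real.exp (k / 2) ≤ 2 ^ k := by
    have h3 : Real.exp (1 / 2) ≤ 2 := by
      calc Real.exp (1 / 2) ≤ Real.exp (Real.log 2) :=
            Real.exp_le_exp.2 (by linarith [Real.log_two_gt_d9])
        _ = 2 := Real.exp_log (by norm_num)
    calc Real.exp (k / 2) = Real.exp (1 / 2) ^ k := by rw [← Real.exp_nat_mul]; congr 1; ring
      _ ≤ _ := pow_le_pow_left₀ (Real.exp_nonneg _) h3 k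
  have h3 : Real.exp (k / 2 + -(n₀ / 288)) < Real.exp 0 := by
    rw [Real.exp_add, Real.exp_zero]
    exact lt_of_le_of_lt (mul_le_mul_of_nonneg_right h2 (Real.exp_nonneg _)) h1
  have h4 := Real.exp_lt_exp.1 h3
  have h5 : (24 * k : ℝ) ≤ n₀ := by linarith [show (0 : ℝ) ≤ k from Nat.cast_nonneg _]
  exact_mod_cast h5

theorem one_le_sqrt_two_pi_exp : 1 ≤ √(2 * Real.pi * Real.exp 1) := by
  rw [Real.one_le_sqrt]
  nlinarith [Real.pi_gt_three, two_lt_exp_one]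

end KdTree

/-! ### Assembly -/

open KdTree in
theorem theorem4p1 :
    ∃ c : ℝ, 0 < c ∧
      ∀ (d : ℕ) [NeZero d] (n n₀ k : ℕ), 11 ≤ n₀ → 0 < k → n = 2 ^ k * n₀ →
      ∀ q ∈ KdTree.unitCube d,
      ∀ {Ω : Type*} [MeasurableSpace Ω] (P : Measure Ω) [IsProbabilityMeasure P]
        (X : Fin n → Ω → EuclideanSpace ℝ (Fin d)),
        (∀ i, Measurable (X i)) →
        iIndepFun X P →
        (∀ i, pdf.IsUniform (X i) (KdTree.unitCube d) P volume) →
        1 - 3 * (n : ℝ) * Real.exp (-c * n₀) ≤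
          P.real {ω | ∃ T : KdTree.Tree d (Fin n),
            KdTree.Builds (fun i => X i ω) n₀ 0 Finset.univ T ∧
            (KdTree.numVisited (fun i => X i ω) q T : ℝ) ≤
              4 * (8 * √(2 * Real.pi * Real.exp 1)) ^ d} := by
  refine ⟨1 / 288, by norm_num, ?_⟩
  intro d _ n n₀ k hn₀ _ hn q hq Ω _ P _ X hX hind hunif
  have hn₀' : 0 < n₀ := by omega
  have hcard : Fintype.card (Fin n) = 2 ^ k * n₀ := by rw [Fintype.card_fin, hn]
  have hexp : Real.exp (-(1 / 288) * n₀) = Real.exp (-(n₀ / 288)) := by congr 1; ring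
  have hpos := Real.exp_pos (-(n₀ / 288 : ℝ))
  rw [hexp]
  set Y : Ω → Fin n → Fin d → ℝ := fun ω i a => X i ω a with hY
  have hYm : Measurable Y := by
    refine measurable_pi_lambda _ fun i => measurable_pi_lambda _ fun a => ?_
    have := hX i
    fun_prop
  have hlaw : P.map Y = Measure.pi fun _ => unitLaw d := map_eq_pi_unitLaw P hX hind hunif
  have hgp : ∀ᵐ ω ∂P, InGeneralPosition (Y ω) := by
    have := ae_inGeneralPosition (d := d) (Fin n)
    rw [← hlaw] at this
    exact ae_of_ae_map hYm.aemeasurable this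
  have hbuild : ∀ ω, InGeneralPosition (Y ω) →
      Builds (fun i => X i ω) n₀ 0 Finset.univ (treeAt (Y ω) k []) := fun ω hω =>
    builds_treeAt (fun _ _ => rfl) hω hn₀' hcard k [] (by simp)
  have hs : 1 ≤ √(2 * Real.pi * Real.exp 1) := one_le_sqrt_two_pi_exp
  by_cases hkd : k ≤ d
  · have hall : ∀ᵐ ω ∂P, ω ∈ {ω | ∃ T : Tree d (Fin n), Builds (fun i => X i ω) n₀ 0 Finset.univ T ∧
        (numVisited (fun i => X i ω) q T : ℝ) ≤ 4 * (8 * √(2 * Real.pi * Real.exp 1)) ^ d} := by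
      filter_upwards [hgp] with ω hω
      refine ⟨_, hbuild ω hω, ?_⟩
      have h1 : (numVisited (fun i => X i ω) q (treeAt (Y ω) k []) : ℝ) ≤ 2 ^ k := by
        exact_mod_cast length_search_le (Y ω) (fun i => X i ω) q k [] (unitCube d) none
      have h2 : (2 : ℝ) ^ k ≤ 2 ^ d := pow_le_pow_right₀ (by norm_num) hkd
      have h3 : (2 : ℝ) ^ d ≤ (8 * √(2 * Real.pi * Real.exp 1)) ^ d :=
        pow_le_pow_left₀ (by norm_num) (by linarith) d
      have h4 : (0 : ℝ) ≤ 2 ^ d := by positivity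
      linarith
    refine le_trans ?_ (ENNReal.toReal_mono (measure_ne_top _ _)
      (measure_mono_ae (s := Set.univ) (hall.mono fun ω h _ => h)))
    rw [measure_univ, ENNReal.toReal_one]
    have : 0 ≤ 3 * (n : ℝ) * Real.exp (-(n₀ / 288)) := by positivity
    linarith
  -- If the failure bound reaches 1, the claim is vacuous. Otherwise it limits k, and d < k
  -- transfers the limit to d.
  · by_cases htriv : 1 ≤ 3 * (n : ℝ) * Real.exp (-(n₀ / 288))
    · exact le_trans (by linarith) measureReal_nonneg
    have hlev : 24 * d ≤ n₀ := by
      have : 24 * k ≤ n₀ := by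
        refine mul_levels_le hn₀' ?_
        have h1 : (2 : ℝ) ^ k * n₀ = n := by rw [hn]; push_cast; ring
        rw [h1]
        have : 0 ≤ (n : ℝ) * Real.exp (-(n₀ / 288)) := by positivity
        linarith
      omega
    have hbad : P.real {ω | ¬ Balanced (Y ω) k n₀} ≤ 2 ^ k * (2 * Real.exp (-(n₀ / 288))) := by
      have h1 := measure_not_balanced_le (d := d) (ι := Fin n) k n₀ hn₀' hlev
      change Measure.pi (fun _ => unitLaw d) {x | KdTree.Balanced x k n₀}ᶜ ≤ _ at h1
      rw [← hlaw, Measure.map_apply hYm (measurableSet_balanced k n₀).compl] at h1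
      exact ENNReal.toReal_le_of_le_ofReal (by positivity) h1
    have hmB : MeasurableSet {ω | Balanced (Y ω) k n₀} := hYm (measurableSet_balanced k n₀)
    have hgood : P.real {ω | Balanced (Y ω) k n₀} = 1 - P.real {ω | ¬ Balanced (Y ω) k n₀} := by
      have := probReal_compl_eq_one_sub hmB (μ := P)
      change P.real {ω | ¬ Balanced (Y ω) k n₀} = _ at this
      linarith
    have hmono : P.real {ω | Balanced (Y ω) k n₀} ≤
        P.real {ω | ∃ T : Tree d (Fin n), Builds (fun i => X i ω) n₀ 0 Finset.univ T ∧
        (numVisited (fun i => X i ω) q T : ℝ) ≤ 4 * (8 * √(2 * Real.pi * Real.exp 1)) ^ d} := by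
      refine ENNReal.toReal_mono (measure_ne_top _ _) (measure_mono_ae ?_)
      filter_upwards [hgp] with ω hω hb
      refine ⟨_, hbuild ω hω, ?_⟩
      have h1 := numVisited_le_of_balanced (p := fun i => X i ω) (fun _ _ => rfl) hb hω hn₀' hcard hq
      have h2 : 0 ≤ (8 * √(2 * Real.pi * Real.exp 1)) ^ d := by positivity
      linarith
    -- The union bound costs 2·2^k, far below 3n = 3·2^k·n₀.
    have hn2 : (2 : ℝ) ^ k * 2 ≤ 3 * n := by
      have h1 : (2 : ℝ) ^ k * n₀ = n := by rw [hn]; push_cast; ring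
      have h2 : (11 : ℝ) ≤ n₀ := by exact_mod_cast hn₀
      nlinarith [show (0 : ℝ) < 2 ^ k by positivity]
    have := mul_le_mul_of_nonneg_right hn2 hpos.le
    linarith
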